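/- Let $\mathbf{B}$ be a symmetric monoidal bicategory (fully weak) with unit object $I$, equipped with a reversal operation $\dagger$: an involution on 2-cells, sending $\beta : S \Rightarrow T$ to $\beta^\dagger : T \Rightarrow S$, which is the identity on objects and 1-cells and contravariant for vertical composition, and which preserves all the structure (it commutes with horizontal composition and with the tensor product, and every structure 2-cell of the symmetric monoidal bicategory is unitary). A 2-cell $\mu$ is unitary if $\mu^\dagger\cdot\mu=\mathrm{id}$ and $\mu\cdot\mu^\dagger=\mathrm{id}$. The scalars, i.e. the 1-cells $I\to I$ and the 2-cells between them, form a symmetric monoidal category whose tensor product $\otimes$ is composition of 1-cells, and whose symmetry is induced by the braiding of $\mathbf{B}$ via the canonical identification of the tensor product of two scalars with their composite. Witnesses for an object $A$ are 1-cells $l : I\to A$ and $r : A\to I$ (composites of 1-cells are written in diagrammatic order, so that $l\,r : I \to A \to I$ and $r\,l : A \to I \to A$) with 2-cells $\eta : \mathrm{id}_I\Rightarrow l\,r$ ("create") and $\varepsilon : r\,l\Rightarrow \mathrm{id}_A$ ("compare") such that: $\eta,\varepsilon$ are the unit and counit of an adjunction $l\dashv r$, and $\varepsilon^\dagger$ ("copy")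 and $\eta^\dagger$ ("delete") are the unit and counit of an adjunction $r\dashv l$; $\varepsilon\cdot\varepsilon^\dagger=\mathrm{id}$; and the 2-cell $m : (l\,r)\otimes(l\,r)\Rightarrow l\,r$ obtained by applying $\varepsilon$ to the inner two factors is unchanged by precomposition with the symmetry of the scalars. A nondegenerate measurement of a scalar $S : I\to I$ with respect to these witnesses is a unitary 2-cell $U : S\Rightarrow l\,r$. A commutative $\dagger$-Frobenius algebra on a scalar $X$ is a commutative monoid $(X,\mu,\iota)$ in the symmetric monoidal category of scalars satisfying $(\mu\otimes \mathrm{id})\cdot(\mathrm{id}\otimes\mu^\dagger)=(\mathrm{id}\otimes\mu)\cdot(\mu^\dagger\otimes\mathrm{id})$ (up to associators). **Theorem.** Let $(l,r,\eta,\varepsilon)$ be witnesses for an object $A$, and let $U : S\Rightarrow l\,r$ be a nondegenerate measurement of a scalar $S$. Then $(l\,r,\,m,\,\eta)$ is a commutative $\dagger$-Frobenius algebra, and its transport along $U$, with multiplication $U^\dagger\cdot m\cdot(U\otimes U)$ and unit $U^\dagger\cdot\eta$, is a commutative $\dagger$-Frobenius algebra on the measured system $S$. -/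

import Mathlib

open CategoryTheory Bicategory
open scoped Pseudofunctor.StrongTrans

universe w v u

noncomputable section

universe w₁ w₂ w₃ w₄ v₁ v₂ v₃ v₄ u₁ u₂ u₃ u₄

namespace TwoCat

/-! ### Pseudofunctors between products of bicategories -/

section Products

/-- The product `F × G : C × D ⥤ᵖ C' × D'` of two pseudofunctors. -/
@[simps!]
def prodMap {C : Type u₁} [Bicategory.{w₁, v₁} C] {C' : Type u₂} [Bicategory.{w₂, v₂} C']
    {D : Type u₃} [Bicategory.{w₃, v₃} D] {D' : Type u₄} [Bicategory.{w₄, v₄} D']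
    (F : C ⥤ᵖ C') (G : D ⥤ᵖ D') : (C × D) ⥤ᵖ (C' × D') where
  obj X := (F.obj X.1, G.obj X.2)
  map f := (F.map f.1, G.map f.2)
  map₂ η := (F.map₂ η.1, G.map₂ η.2)
  mapId X := Iso.prod (F.mapId X.1) (G.mapId X.2)
  mapComp f g := Iso.prod (F.mapComp f.1 g.1) (G.mapComp f.2 g.2)

/-- The rebracketing `(B × B) × B ⥤ᵖ B × (B × B)`. -/
@[simps!]
def prodAssoc (B : Type u) [Bicategory.{w, v} B] : ((B × B) × B) ⥤ᵖ (B × (B × B)) where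
  obj X := (X.1.1, (X.1.2, X.2))
  map f := (f.1.1, (f.1.2, f.2))
  map₂ η := (η.1.1, (η.1.2, η.2))
  mapId X := Iso.refl _
  mapComp f g := Iso.refl _

end Products

/-! ### Invertible squares

`Sq p q f g` is the type of invertible 2-cells filling the square with sides `f`, `g` and
components `p`, `q`; the naturality cells of a pseudonatural transformation are of this form. -/

section Squares

variable {B : Type u} [Bicategory.{w, v} B]

/-- Invertible 2-cells `f ≫ q ≅ p ≫ g`. -/
abbrev Sq {X Y X' Y' : B} (p : X ⟶ Y) (q : X' ⟶ Y') (f : X ⟶ X') (g : Y ⟶ Y') :=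
  f ≫ q ≅ p ≫ g

/-- The identity square on a 1-cell. -/
def Sq.refl {X X' : B} (f : X ⟶ X') : Sq (𝟙 X) (𝟙 X') f f := ρ_ f ≪≫ (λ_ f).symm

/-- Pasting of squares: this is the naturality cell of a composite transformation. -/
def Sq.comp {X Y Z X' Y' Z' : B} {p : X ⟶ Y} {q : X' ⟶ Y'} {p' : Y ⟶ Z} {q' : Y' ⟶ Z'}
    {f : X ⟶ X'} {g : Y ⟶ Y'} {h : Z ⟶ Z'} (s : Sq p q f g) (t : Sq p' q' g h) :
    Sq (p ≫ p') (q ≫ q') f h :=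
  (α_ f q q').symm ≪≫ whiskerRightIso s q' ≪≫ α_ p g q' ≪≫ whiskerLeftIso p t ≪≫
    (α_ p p' h).symm

/-- The modification axiom: a pair of 2-cells `m : p₁ ≅ p₂`, `m' : q₁ ≅ q₂` is compatible with the
naturality squares `s₁`, `s₂`. -/
def Sq.Compatible {X Y X' Y' : B} {p₁ p₂ : X ⟶ Y} {q₁ q₂ : X' ⟶ Y'} {f : X ⟶ X'} {g : Y ⟶ Y'}
    (s₁ : Sq p₁ q₁ f g) (s₂ : Sq p₂ q₂ f g) (m : p₁ ≅ p₂) (m' : q₁ ≅ q₂) : Prop :=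
  f ◁ m'.hom ≫ s₂.hom = s₁.hom ≫ m.hom ▷ g

/-- Cancellation of an equivalence on the right. -/
def cancelRight {X Y Z : B} {f g : X ⟶ Y} (e : Y ⟶ Z) (e' : Z ⟶ Y) (η : 𝟙 Y ≅ e ≫ e')
    (i : f ≫ e ≅ g ≫ e) : f ≅ g :=
  (ρ_ f).symm ≪≫ whiskerLeftIso f η ≪⊗≫ whiskerRightIso i e' ≪⊗≫ whiskerLeftIso g η.symm ≪≫ ρ_ g

/-- Cancellation of an equivalence on the left. -/
def cancelLeft {X Y Z : B} {f g : Y ⟶ Z} (e : X ⟶ Y) (e' : Y ⟶ X) (ξ : e' ≫ e ≅ 𝟙 Y)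
    (i : e ≫ f ≅ e ≫ g) : f ≅ g :=
  (λ_ f).symm ≪≫ whiskerRightIso ξ.symm f ≪⊗≫ whiskerLeftIso e' i ≪⊗≫ whiskerRightIso ξ g ≪≫ λ_ g

/-- The mate `p' ≅ q'` of an isomorphism `p ≅ q` between equivalences with inverses `p'`, `q'`. -/
def invMate {X Y : B} {p q : X ⟶ Y} {p' q' : Y ⟶ X} (m : p ≅ q) (η : 𝟙 X ≅ p ≫ p')
    (ξ : q' ≫ q ≅ 𝟙 Y) : p' ≅ q' :=
  (λ_ p').symm ≪≫ whiskerRightIso ξ.symm p' ≪⊗≫ whiskerLeftIso q' (whiskerRightIso m.symm p') ≪≫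
    whiskerLeftIso q' η.symm ≪≫ ρ_ q'

/-- The unit for a composite of equivalences. -/
def compUnitIso {X Y Z : B} {p : X ⟶ Y} {p' : Y ⟶ X} {q : Y ⟶ Z} {q' : Z ⟶ Y}
    (η : 𝟙 X ≅ p ≫ p') (θ : 𝟙 Y ≅ q ≫ q') : 𝟙 X ≅ (p ≫ q) ≫ q' ≫ p' :=
  η ≪⊗≫ whiskerLeftIso p (whiskerRightIso θ p') ≪⊗≫ Iso.refl _

/-- The counit for a composite of equivalences. -/
def compCounitIso {X Y Z : B} {p : X ⟶ Y} {p' : Y ⟶ X} {q : Y ⟶ Z} {q' : Z ⟶ Y}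
    (ξ : p' ≫ p ≅ 𝟙 Y) (δ : q' ≫ q ≅ 𝟙 Z) : (q' ≫ p') ≫ p ≫ q ≅ 𝟙 Z :=
  Iso.refl _ ≪⊗≫ whiskerLeftIso q' (whiskerRightIso ξ q) ≪⊗≫ δ

end Squares

/-! ### Monoidal bicategories -/

/-- The pseudofunctor `((a, b), c) ↦ (a ⊠ b) ⊠ c`. -/
abbrev tensorLeftAssoc {B : Type u} [Bicategory.{w, v} B] (T : (B × B) ⥤ᵖ B) :
    ((B × B) × B) ⥤ᵖ B :=
  (prodMap T (Pseudofunctor.id B)).comp T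

/-- The pseudofunctor `((a, b), c) ↦ a ⊠ (b ⊠ c)`. -/
abbrev tensorRightAssoc {B : Type u} [Bicategory.{w, v} B] (T : (B × B) ⥤ᵖ B) :
    ((B × B) × B) ⥤ᵖ B :=
  (prodAssoc B).comp ((prodMap (Pseudofunctor.id B) T).comp T)

/-- The underlying data of a monoidal bicategory: a tensor product pseudofunctor, a unit object,
and an associator and unitors, which are adjoint equivalences in the bicategories of
pseudofunctors, strong transformations and modifications. -/
class MonoidalBicategoryData (B : Type u) [Bicategory.{w, v} B] where
  /-- the tensor product -/
  tensor : (B × B) ⥤ᵖ B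
  /-- the unit object -/
  unitObj : B
  /-- the associator `(a ⊠ b) ⊠ c ⟶ a ⊠ (b ⊠ c)` -/
  associator : tensorLeftAssoc tensor ≌ tensorRightAssoc tensor
  /-- the left unitor `I ⊠ a ⟶ a` -/
  leftUnitor : (Bicategory.Prod.sectR unitObj B).toPseudofunctor.comp tensor ≌ Pseudofunctor.id B
  /-- the right unitor `a ⊠ I ⟶ a` -/
  rightUnitor : (Bicategory.Prod.sectL B unitObj).toPseudofunctor.comp tensor ≌ Pseudofunctor.id B

section MonoidalData

variable {B : Type u} [Bicategory.{w, v} B] [MonoidalBicategoryData B]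

open MonoidalBicategoryData

variable (B) in
/-- The unit object. -/
abbrev 𝕀 : B := unitObj

/-- Tensor product of objects. -/
abbrev tObj (a b : B) : B := tensor.obj (a, b)

local infixr:80 " ⊠ " => tObj

/-- Tensor product of 1-cells. -/
abbrev tHom {a a' b b' : B} (f : a ⟶ a') (g : b ⟶ b') : a ⊠ b ⟶ a' ⊠ b' :=
  tensor.map (X := (a, b)) (Y := (a', b')) (f, g)

local infixr:80 " ⊠₁ " => tHom

/-- Tensor product of invertible 2-cells. -/
def t2Iso {a a' b b' : B} {f f' : a ⟶ a'} {g g' : b ⟶ b'} (η : f ≅ f') (θ : g ≅ g') :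
    f ⊠₁ g ≅ f' ⊠₁ g' :=
  tensor.map₂Iso (Iso.prod η θ)

/-- Compatibility of the tensor product with composition of 1-cells. -/
def tComp {a a' a'' b b' b'' : B} (f : a ⟶ a') (f' : a' ⟶ a'') (g : b ⟶ b') (g' : b' ⟶ b'') :
    (f ≫ f') ⊠₁ (g ≫ g') ≅ (f ⊠₁ g) ≫ (f' ⊠₁ g') :=
  tensor.mapComp (a := (a, b)) (b := (a', b')) (c := (a'', b'')) (f, g) (f', g')

/-- Compatibility of the tensor product with identity 1-cells. -/
def tId (a b : B) : 𝟙 a ⊠₁ 𝟙 b ≅ 𝟙 (a ⊠ b) := tensor.mapId (a, b)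

/-- Tensor product of squares. -/
def Sq.tensor {X Y X' Y' Z W Z' W' : B} {p : X ⟶ Y} {q : X' ⟶ Y'} {f : X ⟶ X'} {g : Y ⟶ Y'}
    {p' : Z ⟶ W} {q' : Z' ⟶ W'} {f' : Z ⟶ Z'} {g' : W ⟶ W'}
    (s : Sq p q f g) (t : Sq p' q' f' g') :
    Sq (p ⊠₁ p') (q ⊠₁ q') (f ⊠₁ f') (g ⊠₁ g') :=
  (tComp f q f' q').symm ≪≫ t2Iso s t ≪≫ tComp p g p' g'

/-- Left whiskering `a ⋉ f = 𝟙 a ⊠ f`. -/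
abbrev lwh (a : B) {b b' : B} (f : b ⟶ b') : a ⊠ b ⟶ a ⊠ b' := 𝟙 a ⊠₁ f

/-- Right whiskering `f ⋊ c = f ⊠ 𝟙 c`. -/
abbrev rwh {b b' : B} (f : b ⟶ b') (c : B) : b ⊠ c ⟶ b' ⊠ c := f ⊠₁ 𝟙 c

local infixr:81 " ⋉ " => lwh
local infixl:82 " ⋊ " => rwh

/-- `a ⋉ -` on invertible 2-cells. -/
def lw₂ (a : B) {b b' : B} {f g : b ⟶ b'} (η : f ≅ g) : a ⋉ f ≅ a ⋉ g := t2Iso (Iso.refl _) η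

/-- `- ⋊ c` on invertible 2-cells. -/
def rw₂ {b b' : B} {f g : b ⟶ b'} (η : f ≅ g) (c : B) : f ⋊ c ≅ g ⋊ c := t2Iso η (Iso.refl _)

/-- `a ⋉ -` preserves composition. -/
def lwComp (a : B) {b b' b'' : B} (f : b ⟶ b') (g : b' ⟶ b'') :
    a ⋉ (f ≫ g) ≅ (a ⋉ f) ≫ (a ⋉ g) :=
  t2Iso (λ_ (𝟙 a)).symm (Iso.refl _) ≪≫ tComp (𝟙 a) (𝟙 a) f g

/-- `- ⋊ c` preserves composition. -/
def rwComp {b b' b'' : B} (f : b ⟶ b') (g : b' ⟶ b'') (c : B) :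
    (f ≫ g) ⋊ c ≅ (f ⋊ c) ≫ (g ⋊ c) :=
  t2Iso (Iso.refl _) (λ_ (𝟙 c)).symm ≪≫ tComp f g (𝟙 c) (𝟙 c)

/-- `a ⋉ -` on a composite of three 1-cells. -/
def lwComp₃ (a : B) {b b' b'' b₃ : B} (f : b ⟶ b') (g : b' ⟶ b'') (h : b'' ⟶ b₃) :
    a ⋉ (f ≫ g ≫ h) ≅ (a ⋉ f) ≫ (a ⋉ g) ≫ (a ⋉ h) :=
  lwComp a f (g ≫ h) ≪≫ whiskerLeftIso _ (lwComp a g h)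

/-- `- ⋊ c` on a composite of three 1-cells. -/
def rwComp₃ {b b' b'' b₃ : B} (f : b ⟶ b') (g : b' ⟶ b'') (h : b'' ⟶ b₃) (c : B) :
    (f ≫ g ≫ h) ⋊ c ≅ (f ⋊ c) ≫ (g ⋊ c) ≫ (h ⋊ c) :=
  rwComp f (g ≫ h) c ≪≫ whiskerLeftIso _ (rwComp g h c)

/-- `a ⋉ -` on a unit `𝟙 ≅ f ≫ g`. -/
def lwUnit (a : B) {b b' : B} {f : b ⟶ b'} {g : b' ⟶ b} (η : 𝟙 b ≅ f ≫ g) :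
    𝟙 (a ⊠ b) ≅ (a ⋉ f) ≫ (a ⋉ g) :=
  (tId a b).symm ≪≫ lw₂ a η ≪≫ lwComp a f g

/-- `- ⋊ c` on a unit `𝟙 ≅ f ≫ g`. -/
def rwUnit {b b' : B} {f : b ⟶ b'} {g : b' ⟶ b} (η : 𝟙 b ≅ f ≫ g) (c : B) :
    𝟙 (b ⊠ c) ≅ (f ⋊ c) ≫ (g ⋊ c) :=
  (tId b c).symm ≪≫ rw₂ η c ≪≫ rwComp f g c

/-- The interchange isomorphism. -/
def interchange {a a' b b' : B} (f : a ⟶ a') (g : b ⟶ b') :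
    (f ⋊ b) ≫ (a' ⋉ g) ≅ (a ⋉ g) ≫ (f ⋊ b') :=
  (tComp f (𝟙 a') (𝟙 b) g).symm ≪≫ t2Iso (ρ_ f ≪≫ (λ_ f).symm) (λ_ g ≪≫ (ρ_ g).symm) ≪≫
    tComp (𝟙 a) f g (𝟙 b')

/-! #### The associator -/

/-- Component of the associator. -/
def asc (a b c : B) : (a ⊠ b) ⊠ c ⟶ a ⊠ b ⊠ c := associator.hom.app ((a, b), c)

/-- Component of the inverse associator. -/
def asc' (a b c : B) : a ⊠ b ⊠ c ⟶ (a ⊠ b) ⊠ c := associator.inv.app ((a, b), c)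

/-- Component of the unit of the associator equivalence. -/
def ascUnit (a b c : B) : 𝟙 ((a ⊠ b) ⊠ c) ≅ asc a b c ≫ asc' a b c where
  hom := associator.unit.hom.as.app ((a, b), c)
  inv := associator.unit.inv.as.app ((a, b), c)
  hom_inv_id := congrArg (fun m => m.as.app ((a, b), c)) associator.unit.hom_inv_id
  inv_hom_id := congrArg (fun m => m.as.app ((a, b), c)) associator.unit.inv_hom_id

/-- Component of the counit of the associator equivalence. -/
def ascCounit (a b c : B) : asc' a b c ≫ asc a b c ≅ 𝟙 (a ⊠ b ⊠ c) where
  hom := associator.counit.hom.as.app ((a, b), c)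
  inv := associator.counit.inv.as.app ((a, b), c)
  hom_inv_id := congrArg (fun m => m.as.app ((a, b), c)) associator.counit.hom_inv_id
  inv_hom_id := congrArg (fun m => m.as.app ((a, b), c)) associator.counit.inv_hom_id

section
variable {a a' b b' c c' : B}

/-- Naturality of the associator. -/
def ascNat (f : a ⟶ a') (g : b ⟶ b') (h : c ⟶ c') :
    Sq (asc a b c) (asc a' b' c') ((f ⊠₁ g) ⊠₁ h) (f ⊠₁ g ⊠₁ h) :=
  associator.hom.naturality (a := ((a, b), c)) (b := ((a', b'), c')) ((f, g), h)

/-- Naturality of the inverse associator. -/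
def ascNat' (f : a ⟶ a') (g : b ⟶ b') (h : c ⟶ c') :
    Sq (asc' a b c) (asc' a' b' c') (f ⊠₁ g ⊠₁ h) ((f ⊠₁ g) ⊠₁ h) :=
  associator.inv.naturality (a := ((a, b), c)) (b := ((a', b'), c')) ((f, g), h)

end

/-- Naturality of the associator in the first variable. -/
def ascNatL {a a' : B} (f : a ⟶ a') (b c : B) :
    (f ⋊ b ⋊ c) ≫ asc a' b c ≅ asc a b c ≫ (f ⋊ (b ⊠ c)) :=
  ascNat f (𝟙 b) (𝟙 c) ≪≫ whiskerLeftIso _ (t2Iso (Iso.refl f) (tId b c))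

/-- Naturality of the associator in the second variable. -/
def ascNatM (a : B) {b b' : B} (g : b ⟶ b') (c : B) :
    ((a ⋉ g) ⋊ c) ≫ asc a b' c ≅ asc a b c ≫ (a ⋉ (g ⋊ c)) :=
  ascNat (𝟙 a) g (𝟙 c)

/-- Naturality of the associator in the third variable. -/
def ascNatR (a b : B) {c c' : B} (h : c ⟶ c') :
    ((a ⊠ b) ⋉ h) ≫ asc a b c' ≅ asc a b c ≫ (a ⋉ b ⋉ h) :=
  whiskerRightIso (t2Iso (tId a b).symm (Iso.refl h)) _ ≪≫ ascNat (𝟙 a) (𝟙 b) h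

/-- Naturality of the inverse associator in the first variable. -/
def ascNatL' {a a' : B} (f : a ⟶ a') (b c : B) :
    (f ⋊ (b ⊠ c)) ≫ asc' a' b c ≅ asc' a b c ≫ (f ⋊ b ⋊ c) :=
  whiskerRightIso (t2Iso (Iso.refl f) (tId b c).symm) _ ≪≫ ascNat' f (𝟙 b) (𝟙 c)

/-- Naturality of the inverse associator in the second variable. -/
def ascNatM' (a : B) {b b' : B} (g : b ⟶ b') (c : B) :
    (a ⋉ (g ⋊ c)) ≫ asc' a b' c ≅ asc' a b c ≫ ((a ⋉ g) ⋊ c) :=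
  ascNat' (𝟙 a) g (𝟙 c)

/-- Naturality of the inverse associator in the third variable. -/
def ascNatR' (a b : B) {c c' : B} (h : c ⟶ c') :
    (a ⋉ b ⋉ h) ≫ asc' a b c' ≅ asc' a b c ≫ ((a ⊠ b) ⋉ h) :=
  ascNat' (𝟙 a) (𝟙 b) h ≪≫ whiskerLeftIso _ (t2Iso (tId a b) (Iso.refl h))

/-! #### The unitors -/

/-- Component of the left unitor. -/
def lu (a : B) : 𝕀 B ⊠ a ⟶ a := leftUnitor.hom.app a

/-- Component of the inverse of the left unitor. -/
def lu' (a : B) : a ⟶ 𝕀 B ⊠ a := leftUnitor.inv.app a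

/-- Component of the unit of the left unitor equivalence. -/
def luUnit (a : B) : 𝟙 (𝕀 B ⊠ a) ≅ lu a ≫ lu' a where
  hom := leftUnitor.unit.hom.as.app a
  inv := leftUnitor.unit.inv.as.app a
  hom_inv_id := congrArg (fun m => m.as.app a) leftUnitor.unit.hom_inv_id
  inv_hom_id := congrArg (fun m => m.as.app a) leftUnitor.unit.inv_hom_id

/-- Component of the counit of the left unitor equivalence. -/
def luCounit (a : B) : lu' a ≫ lu a ≅ 𝟙 a where
  hom := leftUnitor.counit.hom.as.app a
  inv := leftUnitor.counit.inv.as.app a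
  hom_inv_id := congrArg (fun m => m.as.app a) leftUnitor.counit.hom_inv_id
  inv_hom_id := congrArg (fun m => m.as.app a) leftUnitor.counit.inv_hom_id

/-- Naturality of the left unitor. -/
def luNat {a a' : B} (f : a ⟶ a') : Sq (lu a) (lu a') (𝕀 B ⋉ f) f :=
  leftUnitor.hom.naturality f

/-- Naturality of the inverse of the left unitor. -/
def luNat' {a a' : B} (f : a ⟶ a') : Sq (lu' a) (lu' a') f (𝕀 B ⋉ f) :=
  leftUnitor.inv.naturality f

/-- Component of the right unitor. -/
def ru (a : B) : a ⊠ 𝕀 B ⟶ a := rightUnitor.hom.app a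

/-- Component of the inverse of the right unitor. -/
def ru' (a : B) : a ⟶ a ⊠ 𝕀 B := rightUnitor.inv.app a

/-- Component of the unit of the right unitor equivalence. -/
def ruUnit (a : B) : 𝟙 (a ⊠ 𝕀 B) ≅ ru a ≫ ru' a where
  hom := rightUnitor.unit.hom.as.app a
  inv := rightUnitor.unit.inv.as.app a
  hom_inv_id := congrArg (fun m => m.as.app a) rightUnitor.unit.hom_inv_id
  inv_hom_id := congrArg (fun m => m.as.app a) rightUnitor.unit.inv_hom_id

/-- Component of the counit of the right unitor equivalence. -/
def ruCounit (a : B) : ru' a ≫ ru a ≅ 𝟙 a where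
  hom := rightUnitor.counit.hom.as.app a
  inv := rightUnitor.counit.inv.as.app a
  hom_inv_id := congrArg (fun m => m.as.app a) rightUnitor.counit.hom_inv_id
  inv_hom_id := congrArg (fun m => m.as.app a) rightUnitor.counit.inv_hom_id

/-- Naturality of the right unitor. -/
def ruNat {a a' : B} (f : a ⟶ a') : Sq (ru a) (ru a') (f ⋊ 𝕀 B) f :=
  rightUnitor.hom.naturality f

/-- Naturality of the inverse of the right unitor. -/
def ruNat' {a a' : B} (f : a ⟶ a') : Sq (ru' a) (ru' a') f (f ⋊ 𝕀 B) :=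
  rightUnitor.inv.naturality f

end MonoidalData

local infixr:80 " ⊠ " => tObj
local infixr:80 " ⊠₁ " => tHom
local infixr:81 " ⋉ " => lwh
local infixl:82 " ⋊ " => rwh

/-- The structure 2-cells of a monoidal bicategory: the pentagonator and the three unit
2-cells, which are invertible modifications. -/
class MonoidalBicategoryCells (B : Type u) [Bicategory.{w, v} B] extends
    MonoidalBicategoryData B where
  /-- the pentagonator -/
  pent (a b c d : B) : (asc a b c ⋊ d) ≫ asc a (b ⊠ c) d ≫ (a ⋉ asc b c d) ≅
    asc (a ⊠ b) c d ≫ asc a b (c ⊠ d)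
  pent_natural {a a' b b' c c' d d' : B} (f : a ⟶ a') (g : b ⟶ b') (h : c ⟶ c') (k : d ⟶ d') :
    Sq.Compatible
      (((ascNat f g h).tensor (Sq.refl k)).comp
        ((ascNat f (g ⊠₁ h) k).comp ((Sq.refl f).tensor (ascNat g h k))))
      ((ascNat (f ⊠₁ g) h k).comp (ascNat f g (h ⊠₁ k)))
      (pent a b c d) (pent a' b' c' d')
  /-- the middle unit 2-cell -/
  midUnit (a b : B) : asc a (𝕀 B) b ≫ (a ⋉ lu b) ≅ ru a ⋊ b
  midUnit_natural {a a' b b' : B} (f : a ⟶ a') (g : b ⟶ b') :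
    Sq.Compatible
      ((ascNat f (𝟙 (𝕀 B)) g).comp ((Sq.refl f).tensor (luNat g)))
      ((ruNat f).tensor (Sq.refl g))
      (midUnit a b) (midUnit a' b')
  /-- the left unit 2-cell -/
  leftUnit (a b : B) : asc (𝕀 B) a b ≫ lu (a ⊠ b) ≅ lu a ⋊ b
  leftUnit_natural {a a' b b' : B} (f : a ⟶ a') (g : b ⟶ b') :
    Sq.Compatible
      ((ascNat (𝟙 (𝕀 B)) f g).comp (luNat (f ⊠₁ g)))
      ((luNat f).tensor (Sq.refl g))
      (leftUnit a b) (leftUnit a' b')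
  /-- the right unit 2-cell -/
  rightUnit (a b : B) : asc a b (𝕀 B) ≫ (a ⋉ ru b) ≅ ru (a ⊠ b)
  rightUnit_natural {a a' b b' : B} (f : a ⟶ a') (g : b ⟶ b') :
    Sq.Compatible
      ((ascNat f g (𝟙 (𝕀 B))).comp ((Sq.refl f).tensor (ruNat g)))
      (ruNat (f ⊠₁ g))
      (rightUnit a b) (rightUnit a' b')

section MonoidalAxioms

variable {B : Type u} [Bicategory.{w, v} B] [MonoidalBicategoryCells B]

open MonoidalBicategoryCells

/-- First side of the associahedron equation. -/
def assocahedronLeft (a b c d e : B) :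
    (asc a b c ⋊ d ⋊ e) ≫ (asc a (b ⊠ c) d ⋊ e) ≫ ((a ⋉ asc b c d) ⋊ e) ≫
        asc a (b ⊠ c ⊠ d) e ≫ (a ⋉ asc b (c ⊠ d) e) ≫ (a ⋉ b ⋉ asc c d e) ≅
      asc ((a ⊠ b) ⊠ c) d e ≫ asc (a ⊠ b) c (d ⊠ e) ≫ asc a b (c ⊠ d ⊠ e) :=
  Iso.refl _ ≪⊗≫
  whiskerRightIso ((rwComp₃ _ _ _ e).symm ≪≫ rw₂ (pent a b c d) e ≪≫ rwComp _ _ e)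
    (asc a (b ⊠ c ⊠ d) e ≫ (a ⋉ asc b (c ⊠ d) e) ≫ (a ⋉ b ⋉ asc c d e)) ≪⊗≫
  whiskerLeftIso (asc (a ⊠ b) c d ⋊ e)
    (whiskerRightIso (pent a b (c ⊠ d) e) (a ⋉ b ⋉ asc c d e)) ≪⊗≫
  whiskerLeftIso ((asc (a ⊠ b) c d ⋊ e) ≫ asc (a ⊠ b) (c ⊠ d) e)
    (ascNatR a b (asc c d e)).symm ≪⊗≫
  whiskerRightIso (pent (a ⊠ b) c d e) (asc a b (c ⊠ d ⊠ e)) ≪⊗≫ Iso.refl _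

/-- Second side of the associahedron equation. -/
def assocahedronRight (a b c d e : B) :
    (asc a b c ⋊ d ⋊ e) ≫ (asc a (b ⊠ c) d ⋊ e) ≫ ((a ⋉ asc b c d) ⋊ e) ≫
        asc a (b ⊠ c ⊠ d) e ≫ (a ⋉ asc b (c ⊠ d) e) ≫ (a ⋉ b ⋉ asc c d e) ≅
      asc ((a ⊠ b) ⊠ c) d e ≫ asc (a ⊠ b) c (d ⊠ e) ≫ asc a b (c ⊠ d ⊠ e) :=
  Iso.refl _ ≪⊗≫
  whiskerLeftIso ((asc a b c ⋊ d ⋊ e) ≫ (asc a (b ⊠ c) d ⋊ e))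
    (whiskerRightIso (ascNatM a (asc b c d) e)
      ((a ⋉ asc b (c ⊠ d) e) ≫ (a ⋉ b ⋉ asc c d e))) ≪⊗≫
  whiskerLeftIso ((asc a b c ⋊ d ⋊ e) ≫ (asc a (b ⊠ c) d ⋊ e) ≫ asc a ((b ⊠ c) ⊠ d) e)
    ((lwComp₃ a _ _ _).symm ≪≫ lw₂ a (pent b c d e) ≪≫ lwComp a _ _) ≪⊗≫
  whiskerLeftIso (asc a b c ⋊ d ⋊ e)
    (whiskerRightIso (pent a (b ⊠ c) d e) (a ⋉ asc b c (d ⊠ e))) ≪⊗≫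
  whiskerRightIso (ascNatL (asc a b c) d e)
    (asc a (b ⊠ c) (d ⊠ e) ≫ (a ⋉ asc b c (d ⊠ e))) ≪⊗≫
  whiskerLeftIso (asc ((a ⊠ b) ⊠ c) d e) (pent a b c (d ⊠ e))

/-- First side of the left normalization equation. -/
def leftNormLeft (a b c : B) :
    (asc a (𝕀 B) b ⋊ c) ≫ asc a (𝕀 B ⊠ b) c ≫ (a ⋉ asc (𝕀 B) b c) ≫ (a ⋉ lu (b ⊠ c)) ≅
      asc (a ⊠ 𝕀 B) b c ≫ (ru a ⋊ (b ⊠ c)) :=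
  Iso.refl _ ≪⊗≫
  whiskerRightIso (pent a (𝕀 B) b c) (a ⋉ lu (b ⊠ c)) ≪⊗≫
  whiskerLeftIso (asc (a ⊠ 𝕀 B) b c) (midUnit a (b ⊠ c))

/-- Second side of the left normalization equation. -/
def leftNormRight (a b c : B) :
    (asc a (𝕀 B) b ⋊ c) ≫ asc a (𝕀 B ⊠ b) c ≫ (a ⋉ asc (𝕀 B) b c) ≫ (a ⋉ lu (b ⊠ c)) ≅
      asc (a ⊠ 𝕀 B) b c ≫ (ru a ⋊ (b ⊠ c)) :=
  Iso.refl _ ≪⊗≫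
  whiskerLeftIso ((asc a (𝕀 B) b ⋊ c) ≫ asc a (𝕀 B ⊠ b) c)
    ((lwComp a _ _).symm ≪≫ lw₂ a (leftUnit b c)) ≪⊗≫
  whiskerLeftIso (asc a (𝕀 B) b ⋊ c) (ascNatM a (lu b) c).symm ≪⊗≫
  whiskerRightIso ((rwComp _ _ c).symm ≪≫ rw₂ (midUnit a b) c) (asc a b c) ≪⊗≫
  ascNatL (ru a) b c

/-- First side of the right normalization equation. -/
def rightNormLeft (a b c : B) :
    (asc a b (𝕀 B) ⋊ c) ≫ asc a (b ⊠ 𝕀 B) c ≫ (a ⋉ asc b (𝕀 B) c) ≫ (a ⋉ b ⋉ lu c) ≅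
      (ru (a ⊠ b) ⋊ c) ≫ asc a b c :=
  Iso.refl _ ≪⊗≫
  whiskerRightIso (pent a b (𝕀 B) c) (a ⋉ b ⋉ lu c) ≪⊗≫
  whiskerLeftIso (asc (a ⊠ b) (𝕀 B) c) (ascNatR a b (lu c)).symm ≪⊗≫
  whiskerRightIso (midUnit (a ⊠ b) c) (asc a b c)

/-- Second side of the right normalization equation. -/
def rightNormRight (a b c : B) :
    (asc a b (𝕀 B) ⋊ c) ≫ asc a (b ⊠ 𝕀 B) c ≫ (a ⋉ asc b (𝕀 B) c) ≫ (a ⋉ b ⋉ lu c) ≅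
      (ru (a ⊠ b) ⋊ c) ≫ asc a b c :=
  Iso.refl _ ≪⊗≫
  whiskerLeftIso ((asc a b (𝕀 B) ⋊ c) ≫ asc a (b ⊠ 𝕀 B) c)
    ((lwComp a _ _).symm ≪≫ lw₂ a (midUnit b c)) ≪⊗≫
  whiskerLeftIso (asc a b (𝕀 B) ⋊ c) (ascNatM a (ru b) c).symm ≪⊗≫
  whiskerRightIso ((rwComp _ _ c).symm ≪≫ rw₂ (rightUnit a b) c) (asc a b c)

end MonoidalAxioms

/-- A monoidal bicategory (a one-object tricategory). -/
class MonoidalBicategory (B : Type u) [Bicategory.{w, v} B] extends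
    MonoidalBicategoryCells B where
  assocahedron (a b c d e : B) : assocahedronLeft a b c d e = assocahedronRight a b c d e
  leftNorm (a b c : B) : leftNormLeft a b c = leftNormRight a b c
  rightNorm (a b c : B) : rightNormLeft a b c = rightNormRight a b c

/-! ### Braided, sylleptic and symmetric monoidal bicategories -/

section PentagonMates

variable {B : Type u} [Bicategory.{w, v} B] [MonoidalBicategory B]

open MonoidalBicategoryCells

/-- The pentagonator for the inverse associator. -/
def pentInv (a b c d : B) : (a ⋉ asc' b c d) ≫ asc' a (b ⊠ c) d ≫ (asc' a b c ⋊ d) ≅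
    asc' a b (c ⊠ d) ≫ asc' (a ⊠ b) c d :=
  Iso.refl _ ≪⊗≫
  invMate (pent a b c d)
    (compUnitIso (rwUnit (ascUnit a b c) d)
      (compUnitIso (ascUnit a (b ⊠ c) d) (lwUnit a (ascUnit b c d))))
    (compCounitIso (ascCounit (a ⊠ b) c d) (ascCounit a b (c ⊠ d))) ≪⊗≫ Iso.refl _

/-- A mate of the pentagonator. -/
def pentA (a b c d : B) : asc a (b ⊠ c) d ≫ (a ⋉ asc b c d) ≫ asc' a b (c ⊠ d) ≅
    (asc' a b c ⋊ d) ≫ asc (a ⊠ b) c d :=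
  (λ_ _).symm ≪≫ whiskerRightIso (rwUnit (ascCounit a b c).symm d) _ ≪⊗≫
  whiskerLeftIso (asc' a b c ⋊ d) (whiskerRightIso (pent a b c d) (asc' a b (c ⊠ d))) ≪⊗≫
  whiskerLeftIso ((asc' a b c ⋊ d) ≫ asc (a ⊠ b) c d) (ascUnit a b (c ⊠ d)).symm ≪⊗≫ Iso.refl _

/-- A mate of the pentagonator. -/
def pentB (a b c d : B) : asc a b (c ⊠ d) ≫ (a ⋉ asc' b c d) ≫ asc' a (b ⊠ c) d ≅
    asc' (a ⊠ b) c d ≫ (asc a b c ⋊ d) :=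
  (λ_ _).symm ≪≫ whiskerRightIso (ascCounit (a ⊠ b) c d).symm _ ≪⊗≫
  whiskerLeftIso (asc' (a ⊠ b) c d)
    (whiskerRightIso (pent a b c d).symm ((a ⋉ asc' b c d) ≫ asc' a (b ⊠ c) d)) ≪⊗≫
  whiskerLeftIso (asc' (a ⊠ b) c d ≫ (asc a b c ⋊ d) ≫ asc a (b ⊠ c) d)
    (whiskerRightIso (lwUnit a (ascUnit b c d)).symm (asc' a (b ⊠ c) d)) ≪⊗≫
  whiskerLeftIso (asc' (a ⊠ b) c d ≫ (asc a b c ⋊ d)) (ascUnit a (b ⊠ c) d).symm ≪⊗≫ Iso.refl _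

/-- A mate of the pentagonator. -/
def pentC (a b c d : B) : asc a (b ⊠ c) d ≅
    (asc' a b c ⋊ d) ≫ asc (a ⊠ b) c d ≫ asc a b (c ⊠ d) ≫ (a ⋉ asc' b c d) :=
  (λ_ _).symm ≪≫ whiskerRightIso (rwUnit (ascCounit a b c).symm d) _ ≪⊗≫
  whiskerLeftIso ((asc' a b c ⋊ d) ≫ (asc a b c ⋊ d) ≫ asc a (b ⊠ c) d)
    (lwUnit a (ascUnit b c d)) ≪⊗≫
  whiskerLeftIso (asc' a b c ⋊ d) (whiskerRightIso (pent a b c d) (a ⋉ asc' b c d)) ≪⊗≫ Iso.refl _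

/-- A mate of the pentagonator. -/
def pentD (a b c d : B) : asc' a (b ⊠ c) d ≅
    (a ⋉ asc b c d) ≫ asc' a b (c ⊠ d) ≫ asc' (a ⊠ b) c d ≫ (asc a b c ⋊ d) :=
  (λ_ _).symm ≪≫ whiskerRightIso (lwUnit a (ascUnit b c d)) _ ≪⊗≫
  whiskerLeftIso ((a ⋉ asc b c d) ≫ (a ⋉ asc' b c d) ≫ asc' a (b ⊠ c) d)
    (rwUnit (ascCounit a b c).symm d) ≪⊗≫
  whiskerLeftIso (a ⋉ asc b c d) (whiskerRightIso (pentInv a b c d) (asc a b c ⋊ d)) ≪⊗≫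
    Iso.refl _

end PentagonMates

/-- A monoidal bicategory with a braiding, an adjoint equivalence
`a ⊠ b ⟶ b ⊠ a` of pseudofunctors. -/
class BraidingData (B : Type u) [Bicategory.{w, v} B] extends MonoidalBicategory B where
  /-- the braiding -/
  braiding : tensor ≌ (Bicategory.Prod.swap B B).toPseudofunctor.comp tensor

section BraidingData

variable {B : Type u} [Bicategory.{w, v} B] [BraidingData B]

open BraidingData

/-- Component of the braiding. -/
def br (a b : B) : a ⊠ b ⟶ b ⊠ a := braiding.hom.app (a, b)

/-- Component of the inverse braiding. -/
def br' (a b : B) : b ⊠ a ⟶ a ⊠ b := braiding.inv.app (a, b)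

/-- Component of the unit of the braiding equivalence. -/
def brUnit (a b : B) : 𝟙 (a ⊠ b) ≅ br a b ≫ br' a b where
  hom := braiding.unit.hom.as.app (a, b)
  inv := braiding.unit.inv.as.app (a, b)
  hom_inv_id := congrArg (fun m => m.as.app (a, b)) braiding.unit.hom_inv_id
  inv_hom_id := congrArg (fun m => m.as.app (a, b)) braiding.unit.inv_hom_id

/-- Component of the counit of the braiding equivalence. -/
def brCounit (a b : B) : br' a b ≫ br a b ≅ 𝟙 (b ⊠ a) where
  hom := braiding.counit.hom.as.app (a, b)
  inv := braiding.counit.inv.as.app (a, b)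
  hom_inv_id := congrArg (fun m => m.as.app (a, b)) braiding.counit.hom_inv_id
  inv_hom_id := congrArg (fun m => m.as.app (a, b)) braiding.counit.inv_hom_id

/-- Naturality of the braiding. -/
def brNat {a a' b b' : B} (f : a ⟶ a') (g : b ⟶ b') :
    Sq (br a b) (br a' b') (f ⊠₁ g) (g ⊠₁ f) :=
  braiding.hom.naturality (a := (a, b)) (b := (a', b')) (f, g)

/-- Naturality of the inverse braiding. -/
def brNat' {a a' b b' : B} (f : a ⟶ a') (g : b ⟶ b') :
    Sq (br' a b) (br' a' b') (g ⊠₁ f) (f ⊠₁ g) :=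
  braiding.inv.naturality (a := (a, b)) (b := (a', b')) (f, g)

/-- Naturality of the braiding in the first variable. -/
def brNatL {a a' : B} (f : a ⟶ a') (b : B) : (f ⋊ b) ≫ br a' b ≅ br a b ≫ (b ⋉ f) :=
  brNat f (𝟙 b)

/-- Naturality of the braiding in the second variable. -/
def brNatR (a : B) {b b' : B} (g : b ⟶ b') : (a ⋉ g) ≫ br a b' ≅ br a b ≫ (g ⋊ a) :=
  brNat (𝟙 a) g

end BraidingData

/-- The hexagonators of a braided monoidal bicategory, which are invertible modifications. -/
class BraidedCells (B : Type u) [Bicategory.{w, v} B] extends BraidingData B where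
  /-- the hexagonator moving `a` past `b` and `c` -/
  hexR (a b c : B) : asc a b c ≫ br a (b ⊠ c) ≫ asc b c a ≅
    (br a b ⋊ c) ≫ asc b a c ≫ (b ⋉ br a c)
  hexR_natural {a a' b b' c c' : B} (f : a ⟶ a') (g : b ⟶ b') (h : c ⟶ c') :
    Sq.Compatible
      ((ascNat f g h).comp ((brNat f (g ⊠₁ h)).comp (ascNat g h f)))
      (((brNat f g).tensor (Sq.refl h)).comp
        ((ascNat g f h).comp ((Sq.refl g).tensor (brNat f h))))
      (hexR a b c) (hexR a' b' c')
  /-- the hexagonator moving `a` and `b` past `c` -/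
  hexS (a b c : B) : asc' a b c ≫ br (a ⊠ b) c ≫ asc' c a b ≅
    (a ⋉ br b c) ≫ asc' a c b ≫ (br a c ⋊ b)
  hexS_natural {a a' b b' c c' : B} (f : a ⟶ a') (g : b ⟶ b') (h : c ⟶ c') :
    Sq.Compatible
      ((ascNat' f g h).comp ((brNat (f ⊠₁ g) h).comp (ascNat' h f g)))
      (((Sq.refl f).tensor (brNat g h)).comp
        ((ascNat' f h g).comp ((brNat f h).tensor (Sq.refl g))))
      (hexS a b c) (hexS a' b' c')

section BraidedAxioms

variable {B : Type u} [Bicategory.{w, v} B] [BraidedCells B]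

open MonoidalBicategoryCells BraidedCells

/-- First side of the equation for moving `a` past `b`, `c`, `d`. -/
def braidRLeft (a b c d : B) :
    asc (a ⊠ b) c d ≫ asc a b (c ⊠ d) ≫ br a (b ⊠ c ⊠ d) ≫ asc b (c ⊠ d) a ≫ (b ⋉ asc c d a) ≅
      (br a b ⋊ c ⋊ d) ≫ (asc b a c ⋊ d) ≫ ((b ⋉ br a c) ⋊ d) ≫ asc b (c ⊠ a) d ≫
        (b ⋉ asc c a d) ≫ (b ⋉ c ⋉ br a d) :=
  Iso.refl _ ≪⊗≫
  whiskerRightIso (pent a b c d).symm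
    (br a (b ⊠ c ⊠ d) ≫ asc b (c ⊠ d) a ≫ (b ⋉ asc c d a)) ≪⊗≫
  whiskerLeftIso ((asc a b c ⋊ d) ≫ asc a (b ⊠ c) d)
    (whiskerRightIso (brNatR a (asc b c d)) (asc b (c ⊠ d) a ≫ (b ⋉ asc c d a))) ≪⊗≫
  whiskerLeftIso ((asc a b c ⋊ d) ≫ asc a (b ⊠ c) d ≫ br a ((b ⊠ c) ⊠ d)) (pent b c d a) ≪⊗≫
  whiskerLeftIso (asc a b c ⋊ d) (whiskerRightIso (hexR a (b ⊠ c) d) (asc b c (d ⊠ a))) ≪⊗≫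
  whiskerLeftIso ((asc a b c ⋊ d) ≫ (br a (b ⊠ c) ⋊ d) ≫ asc (b ⊠ c) a d)
    (ascNatR b c (br a d)) ≪⊗≫
  whiskerLeftIso ((asc a b c ⋊ d) ≫ (br a (b ⊠ c) ⋊ d))
    (whiskerRightIso (pent b c a d).symm (b ⋉ c ⋉ br a d)) ≪⊗≫
  whiskerRightIso ((rwComp₃ _ _ _ d).symm ≪≫ rw₂ (hexR a b c) d ≪≫ rwComp₃ _ _ _ d)
    (asc b (c ⊠ a) d ≫ (b ⋉ asc c a d) ≫ (b ⋉ c ⋉ br a d)) ≪⊗≫ Iso.refl _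

/-- Second side of the equation for moving `a` past `b`, `c`, `d`. -/
def braidRRight (a b c d : B) :
    asc (a ⊠ b) c d ≫ asc a b (c ⊠ d) ≫ br a (b ⊠ c ⊠ d) ≫ asc b (c ⊠ d) a ≫ (b ⋉ asc c d a) ≅
      (br a b ⋊ c ⋊ d) ≫ (asc b a c ⋊ d) ≫ ((b ⋉ br a c) ⋊ d) ≫ asc b (c ⊠ a) d ≫
        (b ⋉ asc c a d) ≫ (b ⋉ c ⋉ br a d) :=
  Iso.refl _ ≪⊗≫
  whiskerLeftIso (asc (a ⊠ b) c d) (whiskerRightIso (hexR a b (c ⊠ d)) (b ⋉ asc c d a)) ≪⊗≫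
  whiskerRightIso (ascNatL (br a b) c d).symm
    (asc b a (c ⊠ d) ≫ (b ⋉ br a (c ⊠ d)) ≫ (b ⋉ asc c d a)) ≪⊗≫
  whiskerLeftIso (br a b ⋊ c ⋊ d)
    (whiskerRightIso (pent b a c d).symm ((b ⋉ br a (c ⊠ d)) ≫ (b ⋉ asc c d a))) ≪⊗≫
  whiskerLeftIso ((br a b ⋊ c ⋊ d) ≫ (asc b a c ⋊ d) ≫ asc b (a ⊠ c) d)
    ((lwComp₃ b _ _ _).symm ≪≫ lw₂ b (hexR a c d) ≪≫ lwComp₃ b _ _ _) ≪⊗≫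
  whiskerLeftIso ((br a b ⋊ c ⋊ d) ≫ (asc b a c ⋊ d))
    (whiskerRightIso (ascNatM b (br a c) d).symm ((b ⋉ asc c a d) ≫ (b ⋉ c ⋉ br a d))) ≪⊗≫
  Iso.refl _

/-- First side of the equation for moving `a`, `b`, `c` past `d`. -/
def braidSLeft (a b c d : B) :
    asc' a b (c ⊠ d) ≫ asc' (a ⊠ b) c d ≫ br ((a ⊠ b) ⊠ c) d ≫ asc' d (a ⊠ b) c ≫
        (asc' d a b ⋊ c) ≅
      (a ⋉ b ⋉ br c d) ≫ (a ⋉ asc' b d c) ≫ (a ⋉ (br b d ⋊ c)) ≫ asc' a (d ⊠ b) c ≫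
        (asc' a d b ⋊ c) ≫ (br a d ⋊ b ⋊ c) :=
  Iso.refl _ ≪⊗≫
  whiskerRightIso (pentInv a b c d).symm
    (br ((a ⊠ b) ⊠ c) d ≫ asc' d (a ⊠ b) c ≫ (asc' d a b ⋊ c)) ≪⊗≫
  whiskerLeftIso ((a ⋉ asc' b c d) ≫ asc' a (b ⊠ c) d)
    (whiskerRightIso (brNatL (asc' a b c) d) (asc' d (a ⊠ b) c ≫ (asc' d a b ⋊ c))) ≪⊗≫
  whiskerLeftIso ((a ⋉ asc' b c d) ≫ asc' a (b ⊠ c) d ≫ br (a ⊠ b ⊠ c) d)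
    (pentInv d a b c) ≪⊗≫
  whiskerLeftIso (a ⋉ asc' b c d) (whiskerRightIso (hexS a (b ⊠ c) d) (asc' (d ⊠ a) b c)) ≪⊗≫
  whiskerLeftIso ((a ⋉ asc' b c d) ≫ (a ⋉ br (b ⊠ c) d) ≫ asc' a d (b ⊠ c))
    (ascNatL' (br a d) b c) ≪⊗≫
  whiskerLeftIso ((a ⋉ asc' b c d) ≫ (a ⋉ br (b ⊠ c) d))
    (whiskerRightIso (pentInv a d b c).symm (br a d ⋊ b ⋊ c)) ≪⊗≫
  whiskerRightIso ((lwComp₃ a _ _ _).symm ≪≫ lw₂ a (hexS b c d) ≪≫ lwComp₃ a _ _ _)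
    (asc' a (d ⊠ b) c ≫ (asc' a d b ⋊ c) ≫ (br a d ⋊ b ⋊ c)) ≪⊗≫ Iso.refl _

/-- Second side of the equation for moving `a`, `b`, `c` past `d`. -/
def braidSRight (a b c d : B) :
    asc' a b (c ⊠ d) ≫ asc' (a ⊠ b) c d ≫ br ((a ⊠ b) ⊠ c) d ≫ asc' d (a ⊠ b) c ≫
        (asc' d a b ⋊ c) ≅
      (a ⋉ b ⋉ br c d) ≫ (a ⋉ asc' b d c) ≫ (a ⋉ (br b d ⋊ c)) ≫ asc' a (d ⊠ b) c ≫
        (asc' a d b ⋊ c) ≫ (br a d ⋊ b ⋊ c) :=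
  Iso.refl _ ≪⊗≫
  whiskerLeftIso (asc' a b (c ⊠ d)) (whiskerRightIso (hexS (a ⊠ b) c d) (asc' d a b ⋊ c)) ≪⊗≫
  whiskerRightIso (ascNatR' a b (br c d)).symm
    (asc' (a ⊠ b) d c ≫ (br (a ⊠ b) d ⋊ c) ≫ (asc' d a b ⋊ c)) ≪⊗≫
  whiskerLeftIso (a ⋉ b ⋉ br c d)
    (whiskerRightIso (pentInv a b d c).symm ((br (a ⊠ b) d ⋊ c) ≫ (asc' d a b ⋊ c))) ≪⊗≫
  whiskerLeftIso ((a ⋉ b ⋉ br c d) ≫ (a ⋉ asc' b d c) ≫ asc' a (b ⊠ d) c)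
    ((rwComp₃ _ _ _ c).symm ≪≫ rw₂ (hexS a b d) c ≪≫ rwComp₃ _ _ _ c) ≪⊗≫
  whiskerLeftIso ((a ⋉ b ⋉ br c d) ≫ (a ⋉ asc' b d c))
    (whiskerRightIso (ascNatM' a (br b d) c).symm ((asc' a d b ⋊ c) ≫ (br a d ⋊ b ⋊ c))) ≪⊗≫
  Iso.refl _

/-- First side of the equation for moving `a`, `b` past `c`, `d`. -/
def braidRSLeft (a b c d : B) :
    (asc' a b c ⋊ d) ≫ asc (a ⊠ b) c d ≫ br (a ⊠ b) (c ⊠ d) ≫ asc c d (a ⊠ b) ≫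
        (c ⋉ asc' d a b) ≫ asc' c (d ⊠ a) b ≅
      ((a ⋉ br b c) ⋊ d) ≫ (asc' a c b ⋊ d) ≫ asc (a ⊠ c) b d ≫ (br a c ⋊ (b ⊠ d)) ≫
        ((c ⊠ a) ⋉ br b d) ≫ asc c a (d ⊠ b) ≫ (c ⋉ asc' a d b) ≫ (c ⋉ (br a d ⋊ b)) ≫
          asc' c (d ⊠ a) b :=
  Iso.refl _ ≪⊗≫
  whiskerLeftIso (asc' a b c ⋊ d)
    (whiskerRightIso (hexR (a ⊠ b) c d) ((c ⋉ asc' d a b) ≫ asc' c (d ⊠ a) b)) ≪⊗≫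
  whiskerLeftIso ((asc' a b c ⋊ d) ≫ (br (a ⊠ b) c ⋊ d))
    (whiskerRightIso (pentC c a b d)
      ((c ⋉ br (a ⊠ b) d) ≫ (c ⋉ asc' d a b) ≫ asc' c (d ⊠ a) b)) ≪⊗≫
  whiskerRightIso ((rwComp₃ _ _ _ d).symm ≪≫ rw₂ (hexS a b c) d ≪≫ rwComp₃ _ _ _ d)
    (asc (c ⊠ a) b d ≫ asc c a (b ⊠ d) ≫ (c ⋉ asc' a b d) ≫ (c ⋉ br (a ⊠ b) d) ≫
      (c ⋉ asc' d a b) ≫ asc' c (d ⊠ a) b) ≪⊗≫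
  whiskerLeftIso (((a ⋉ br b c) ⋊ d) ≫ (asc' a c b ⋊ d) ≫ (br a c ⋊ b ⋊ d) ≫
      asc (c ⊠ a) b d ≫ asc c a (b ⊠ d))
    (whiskerRightIso ((lwComp₃ c _ _ _).symm ≪≫ lw₂ c (hexS a b d) ≪≫ lwComp₃ c _ _ _)
      (asc' c (d ⊠ a) b)) ≪⊗≫
  whiskerLeftIso (((a ⋉ br b c) ⋊ d) ≫ (asc' a c b ⋊ d))
    (whiskerRightIso (ascNatL (br a c) b d)
      (asc c a (b ⊠ d) ≫ (c ⋉ a ⋉ br b d) ≫ (c ⋉ asc' a d b) ≫ (c ⋉ (br a d ⋊ b)) ≫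
        asc' c (d ⊠ a) b)) ≪⊗≫
  whiskerLeftIso (((a ⋉ br b c) ⋊ d) ≫ (asc' a c b ⋊ d) ≫ asc (a ⊠ c) b d ≫
      (br a c ⋊ (b ⊠ d)))
    (whiskerRightIso (ascNatR c a (br b d)).symm
      ((c ⋉ asc' a d b) ≫ (c ⋉ (br a d ⋊ b)) ≫ asc' c (d ⊠ a) b)) ≪⊗≫ Iso.refl _

/-- Second side of the equation for moving `a`, `b` past `c`, `d`. -/
def braidRSRight (a b c d : B) :
    (asc' a b c ⋊ d) ≫ asc (a ⊠ b) c d ≫ br (a ⊠ b) (c ⊠ d) ≫ asc c d (a ⊠ b) ≫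
        (c ⋉ asc' d a b) ≫ asc' c (d ⊠ a) b ≅
      ((a ⋉ br b c) ⋊ d) ≫ (asc' a c b ⋊ d) ≫ asc (a ⊠ c) b d ≫ (br a c ⋊ (b ⊠ d)) ≫
        ((c ⊠ a) ⋉ br b d) ≫ asc c a (d ⊠ b) ≫ (c ⋉ asc' a d b) ≫ (c ⋉ (br a d ⋊ b)) ≫
          asc' c (d ⊠ a) b :=
  Iso.refl _ ≪⊗≫
  whiskerRightIso (pentA a b c d).symm
    (br (a ⊠ b) (c ⊠ d) ≫ asc c d (a ⊠ b) ≫ (c ⋉ asc' d a b) ≫ asc' c (d ⊠ a) b) ≪⊗≫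
  whiskerLeftIso (asc a (b ⊠ c) d ≫ (a ⋉ asc b c d) ≫ asc' a b (c ⊠ d) ≫ br (a ⊠ b) (c ⊠ d))
    (pentB c d a b) ≪⊗≫
  whiskerLeftIso (asc a (b ⊠ c) d ≫ (a ⋉ asc b c d))
    (whiskerRightIso (hexS a b (c ⊠ d)) (asc c d a ⋊ b)) ≪⊗≫
  whiskerLeftIso (asc a (b ⊠ c) d ≫ (a ⋉ asc b c d) ≫ (a ⋉ br b (c ⊠ d)))
    (whiskerRightIso (pentD a c d b) ((br a (c ⊠ d) ⋊ b) ≫ (asc c d a ⋊ b))) ≪⊗≫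
  whiskerLeftIso (asc a (b ⊠ c) d)
    (whiskerRightIso ((lwComp₃ a _ _ _).symm ≪≫ lw₂ a (hexR b c d) ≪≫ lwComp₃ a _ _ _)
      (asc' a c (d ⊠ b) ≫ asc' (a ⊠ c) d b ≫ (asc a c d ⋊ b) ≫ (br a (c ⊠ d) ⋊ b) ≫
        (asc c d a ⋊ b))) ≪⊗≫
  whiskerLeftIso (asc a (b ⊠ c) d ≫ (a ⋉ (br b c ⋊ d)) ≫ (a ⋉ asc c b d) ≫
      (a ⋉ c ⋉ br b d) ≫ asc' a c (d ⊠ b) ≫ asc' (a ⊠ c) d b)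
    ((rwComp₃ _ _ _ b).symm ≪≫ rw₂ (hexR a c d) b ≪≫ rwComp₃ _ _ _ b) ≪⊗≫
  whiskerLeftIso (asc a (b ⊠ c) d ≫ (a ⋉ (br b c ⋊ d)) ≫ (a ⋉ asc c b d))
    (whiskerRightIso (ascNatR' a c (br b d))
      (asc' (a ⊠ c) d b ≫ (br a c ⋊ d ⋊ b) ≫ (asc c a d ⋊ b) ≫ ((c ⋉ br a d) ⋊ b))) ≪⊗≫
  whiskerLeftIso (asc a (b ⊠ c) d ≫ (a ⋉ (br b c ⋊ d)) ≫ (a ⋉ asc c b d) ≫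
      asc' a c (b ⊠ d) ≫ ((a ⊠ c) ⋉ br b d))
    (whiskerRightIso (ascNatL' (br a c) d b).symm
      ((asc c a d ⋊ b) ≫ ((c ⋉ br a d) ⋊ b))) ≪⊗≫
  whiskerRightIso (ascNatM a (br b c) d).symm
    ((a ⋉ asc c b d) ≫ asc' a c (b ⊠ d) ≫ ((a ⊠ c) ⋉ br b d) ≫ (br a c ⋊ (d ⊠ b)) ≫
      asc' (c ⊠ a) d b ≫ (asc c a d ⋊ b) ≫ ((c ⋉ br a d) ⋊ b)) ≪⊗≫
  whiskerLeftIso ((a ⋉ br b c) ⋊ d)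
    (whiskerRightIso (pentA a c b d)
      (((a ⊠ c) ⋉ br b d) ≫ (br a c ⋊ (d ⊠ b)) ≫
        asc' (c ⊠ a) d b ≫ (asc c a d ⋊ b) ≫ ((c ⋉ br a d) ⋊ b))) ≪⊗≫
  whiskerLeftIso (((a ⋉ br b c) ⋊ d) ≫ (asc' a c b ⋊ d) ≫ asc (a ⊠ c) b d)
    (whiskerRightIso (interchange (br a c) (br b d)).symm
      (asc' (c ⊠ a) d b ≫ (asc c a d ⋊ b) ≫ ((c ⋉ br a d) ⋊ b))) ≪⊗≫
  whiskerLeftIso (((a ⋉ br b c) ⋊ d) ≫ (asc' a c b ⋊ d) ≫ asc (a ⊠ c) b d ≫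
      (br a c ⋊ (b ⊠ d)) ≫ ((c ⊠ a) ⋉ br b d))
    (whiskerRightIso (pentB c a d b).symm ((c ⋉ br a d) ⋊ b)) ≪⊗≫
  whiskerLeftIso (((a ⋉ br b c) ⋊ d) ≫ (asc' a c b ⋊ d) ≫ asc (a ⊠ c) b d ≫
      (br a c ⋊ (b ⊠ d)) ≫ ((c ⊠ a) ⋉ br b d) ≫ asc c a (d ⊠ b) ≫ (c ⋉ asc' a d b))
    (ascNatM' c (br a d) b).symm ≪⊗≫ Iso.refl _

/-- First side of the Yang–Baxter equation: the Yang–Baxter 2-cell obtained by moving `a` past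
the crossing of `b` and `c`. -/
def yangBaxterLeft (a b c : B) :
    (br a b ⋊ c) ≫ asc b a c ≫ (b ⋉ br a c) ≫ asc' b c a ≫ (br b c ⋊ a) ≫ asc c b a ≅
      asc a b c ≫ (a ⋉ br b c) ≫ asc' a c b ≫ (br a c ⋊ b) ≫ asc c a b ≫ (c ⋉ br a b) :=
  Iso.refl _ ≪⊗≫
  whiskerRightIso (hexR a b c).symm (asc' b c a ≫ (br b c ⋊ a) ≫ asc c b a) ≪⊗≫
  whiskerLeftIso (asc a b c ≫ br a (b ⊠ c))
    (whiskerRightIso (ascUnit b c a).symm ((br b c ⋊ a) ≫ asc c b a)) ≪⊗≫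
  whiskerLeftIso (asc a b c) (whiskerRightIso (brNatR a (br b c)).symm (asc c b a)) ≪⊗≫
  whiskerLeftIso (asc a b c ≫ (a ⋉ br b c))
    (whiskerRightIso (ascCounit a c b).symm (br a (c ⊠ b) ≫ asc c b a)) ≪⊗≫
  whiskerLeftIso (asc a b c ≫ (a ⋉ br b c) ≫ asc' a c b) (hexR a c b) ≪⊗≫ Iso.refl _

/-- Second side of the Yang–Baxter equation: the Yang–Baxter 2-cell obtained by moving the
crossing of `a` and `b` past `c`. -/
def yangBaxterRight (a b c : B) :
    (br a b ⋊ c) ≫ asc b a c ≫ (b ⋉ br a c) ≫ asc' b c a ≫ (br b c ⋊ a) ≫ asc c b a ≅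
      asc a b c ≫ (a ⋉ br b c) ≫ asc' a c b ≫ (br a c ⋊ b) ≫ asc c a b ≫ (c ⋉ br a b) :=
  Iso.refl _ ≪⊗≫
  whiskerLeftIso ((br a b ⋊ c) ≫ asc b a c) (whiskerRightIso (hexS b a c).symm (asc c b a)) ≪⊗≫
  whiskerLeftIso (br a b ⋊ c) (whiskerRightIso (ascUnit b a c).symm
    (br (b ⊠ a) c ≫ asc' c b a ≫ asc c b a)) ≪⊗≫
  whiskerLeftIso ((br a b ⋊ c) ≫ br (b ⊠ a) c) (ascCounit c b a) ≪⊗≫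
  brNatL (br a b) c ≪⊗≫
  whiskerRightIso (ascUnit a b c) (br (a ⊠ b) c ≫ (c ⋉ br a b)) ≪⊗≫
  whiskerLeftIso (asc a b c ≫ asc' a b c ≫ br (a ⊠ b) c)
    (whiskerRightIso (ascCounit c a b).symm (c ⋉ br a b)) ≪⊗≫
  whiskerLeftIso (asc a b c) (whiskerRightIso (hexS a b c) (asc c a b ≫ (c ⋉ br a b))) ≪⊗≫
  Iso.refl _

end BraidedAxioms

/-- A braided monoidal bicategory. -/
class BraidedMonoidalBicategory (B : Type u) [Bicategory.{w, v} B] extends BraidedCells B where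
  braidR (a b c d : B) : braidRLeft a b c d = braidRRight a b c d
  braidS (a b c d : B) : braidSLeft a b c d = braidSRight a b c d
  braidRS (a b c d : B) : braidRSLeft a b c d = braidRSRight a b c d
  yangBaxter (a b c : B) : yangBaxterLeft a b c = yangBaxterRight a b c

/-- The syllepsis, an invertible modification. -/
class SyllepsisData (B : Type u) [Bicategory.{w, v} B] extends BraidedMonoidalBicategory B where
  /-- the syllepsis -/
  syl (a b : B) : 𝟙 (a ⊠ b) ≅ br a b ≫ br b a
  syl_natural {a a' b b' : B} (f : a ⟶ a') (g : b ⟶ b') :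
    Sq.Compatible (Sq.refl (f ⊠₁ g)) ((brNat f g).comp (brNat g f)) (syl a b) (syl a' b')

section SyllepsisAxioms

variable {B : Type u} [Bicategory.{w, v} B] [SyllepsisData B]

open BraidedCells SyllepsisData

/-- First side of the first syllepsis equation. -/
def syllepsisRLeft (a b c : B) : 𝟙 ((a ⊠ b) ⊠ c) ≅
    (br a b ⋊ c) ≫ asc b a c ≫ (b ⋉ br a c) ≫ (b ⋉ br c a) ≫ asc' b a c ≫ (br b a ⋊ c) :=
  ascUnit a b c ≪⊗≫
  whiskerLeftIso (asc a b c) (whiskerRightIso (syl a (b ⊠ c)) (asc' a b c)) ≪⊗≫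
  whiskerLeftIso (asc a b c ≫ br a (b ⊠ c))
    (whiskerRightIso (ascUnit b c a) (br (b ⊠ c) a ≫ asc' a b c)) ≪⊗≫
  whiskerRightIso (hexR a b c) (asc' b c a ≫ br (b ⊠ c) a ≫ asc' a b c) ≪⊗≫
  whiskerLeftIso ((br a b ⋊ c) ≫ asc b a c ≫ (b ⋉ br a c)) (hexS b c a) ≪⊗≫ Iso.refl _

/-- Second side of the first syllepsis equation. -/
def syllepsisRRight (a b c : B) : 𝟙 ((a ⊠ b) ⊠ c) ≅
    (br a b ⋊ c) ≫ asc b a c ≫ (b ⋉ br a c) ≫ (b ⋉ br c a) ≫ asc' b a c ≫ (br b a ⋊ c) :=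
  rwUnit (syl a b) c ≪⊗≫
  whiskerLeftIso (br a b ⋊ c) (whiskerRightIso (ascUnit b a c) (br b a ⋊ c)) ≪⊗≫
  whiskerLeftIso ((br a b ⋊ c) ≫ asc b a c)
    (whiskerRightIso (lwUnit b (syl a c)) (asc' b a c ≫ (br b a ⋊ c))) ≪⊗≫ Iso.refl _

/-- First side of the second syllepsis equation. -/
def syllepsisSLeft (a b c : B) : 𝟙 (a ⊠ b ⊠ c) ≅
    (a ⋉ br b c) ≫ asc' a c b ≫ (br a c ⋊ b) ≫ (br c a ⋊ b) ≫ asc a c b ≫ (a ⋉ br c b) :=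
  (ascCounit a b c).symm ≪⊗≫
  whiskerLeftIso (asc' a b c) (whiskerRightIso (syl (a ⊠ b) c) (asc a b c)) ≪⊗≫
  whiskerLeftIso (asc' a b c ≫ br (a ⊠ b) c)
    (whiskerRightIso (ascCounit c a b).symm (br c (a ⊠ b) ≫ asc a b c)) ≪⊗≫
  whiskerRightIso (hexS a b c) (asc c a b ≫ br c (a ⊠ b) ≫ asc a b c) ≪⊗≫
  whiskerLeftIso ((a ⋉ br b c) ≫ asc' a c b ≫ (br a c ⋊ b)) (hexR c a b) ≪⊗≫ Iso.refl _

/-- Second side of the second syllepsis equation. -/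
def syllepsisSRight (a b c : B) : 𝟙 (a ⊠ b ⊠ c) ≅
    (a ⋉ br b c) ≫ asc' a c b ≫ (br a c ⋊ b) ≫ (br c a ⋊ b) ≫ asc a c b ≫ (a ⋉ br c b) :=
  lwUnit a (syl b c) ≪⊗≫
  whiskerLeftIso (a ⋉ br b c) (whiskerRightIso (ascCounit a c b).symm (a ⋉ br c b)) ≪⊗≫
  whiskerLeftIso ((a ⋉ br b c) ≫ asc' a c b)
    (whiskerRightIso (rwUnit (syl a c) b) (asc a c b ≫ (a ⋉ br c b))) ≪⊗≫ Iso.refl _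

end SyllepsisAxioms

/-- A symmetric monoidal bicategory. -/
class SymmetricMonoidalBicategory (B : Type u) [Bicategory.{w, v} B] extends
    SyllepsisData B where
  syllepsisR (a b c : B) : syllepsisRLeft a b c = syllepsisRRight a b c
  syllepsisS (a b c : B) : syllepsisSLeft a b c = syllepsisSRight a b c
  symmetric (a b : B) :
    (λ_ (br a b)).symm ≪≫ whiskerRightIso (syl a b) (br a b) ≪≫ α_ (br a b) (br b a) (br a b) =
      (ρ_ (br a b)).symm ≪≫ whiskerLeftIso (br a b) (syl b a)

/-! ### Reversal of 2-cells -/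

/-- A reversal operation on a bicategory: an involution `†` on 2-cells, contravariant for vertical
composition and the identity on objects and 1-cells, which preserves the bicategory structure. -/
class DaggerBicategory (B : Type u) [Bicategory.{w, v} B] where
  /-- the reversal of a 2-cell -/
  dag {a b : B} {f g : a ⟶ b} (η : f ⟶ g) : g ⟶ f
  dag_id {a b : B} (f : a ⟶ b) : dag (𝟙 f) = 𝟙 f
  dag_comp {a b : B} {f g h : a ⟶ b} (η : f ⟶ g) (θ : g ⟶ h) : dag (η ≫ θ) = dag θ ≫ dag η
  dag_dag {a b : B} {f g : a ⟶ b} (η : f ⟶ g) : dag (dag η) = η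
  dag_whiskerLeft {a b c : B} (f : a ⟶ b) {g h : b ⟶ c} (η : g ⟶ h) :
    dag (f ◁ η) = f ◁ dag η
  dag_whiskerRight {a b c : B} {f g : a ⟶ b} (η : f ⟶ g) (h : b ⟶ c) :
    dag (η ▷ h) = dag η ▷ h
  dag_associator {a b c d : B} (f : a ⟶ b) (g : b ⟶ c) (h : c ⟶ d) :
    dag (α_ f g h).hom = (α_ f g h).inv
  dag_leftUnitor {a b : B} (f : a ⟶ b) : dag (λ_ f).hom = (λ_ f).inv
  dag_rightUnitor {a b : B} (f : a ⟶ b) : dag (ρ_ f).hom = (ρ_ f).inv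

section Dagger

variable {B : Type u} [Bicategory.{w, v} B] [DaggerBicategory B]

/-- The reversal of a 2-cell. -/
local postfix:max " † " => DaggerBicategory.dag

/-- A 2-cell `η` is an isometry if `η` followed by `η†` is the identity. -/
def IsIsometry {a b : B} {f g : a ⟶ b} (η : f ⟶ g) : Prop := η ≫ η † = 𝟙 f

/-- A 2-cell is unitary if it is an isometry and its reversal is one too. -/
def IsUnitary {a b : B} {f g : a ⟶ b} (η : f ⟶ g) : Prop :=
  IsIsometry η ∧ η † ≫ η = 𝟙 g

end Dagger

local postfix:max " † " => DaggerBicategory.dag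

/-- A symmetric monoidal bicategory with a reversal operation that preserves all of its structure:
the reversal commutes with the tensor product, and all structure 2-cells are unitary. -/
class DaggerSymmetricMonoidalBicategory (B : Type u) [Bicategory.{w, v} B] extends
    SymmetricMonoidalBicategory B, DaggerBicategory B where
  dag_tensor {a a' b b' : B} {f f' : a ⟶ a'} {g g' : b ⟶ b'} (η : f ⟶ f') (θ : g ⟶ g') :
    (tensor.map₂ (a := (a, b)) (b := (a', b')) (f := (f, g)) (g := (f', g')) (η, θ)) † =
      tensor.map₂ (a := (a, b)) (b := (a', b')) (f := (f', g')) (g := (f, g)) (η †, θ †)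
  tComp_unitary {a a' a'' b b' b'' : B} (f : a ⟶ a') (f' : a' ⟶ a'') (g : b ⟶ b')
    (g' : b' ⟶ b'') : IsUnitary (tComp f f' g g').hom
  tId_unitary (a b : B) : IsUnitary (tId a b).hom
  ascNat_unitary {a a' b b' c c' : B} (f : a ⟶ a') (g : b ⟶ b') (h : c ⟶ c') :
    IsUnitary (ascNat f g h).hom
  ascNat'_unitary {a a' b b' c c' : B} (f : a ⟶ a') (g : b ⟶ b') (h : c ⟶ c') :
    IsUnitary (ascNat' f g h).hom
  ascUnit_unitary (a b c : B) : IsUnitary (ascUnit a b c).hom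
  ascCounit_unitary (a b c : B) : IsUnitary (ascCounit a b c).hom
  luNat_unitary {a a' : B} (f : a ⟶ a') : IsUnitary (luNat f).hom
  luNat'_unitary {a a' : B} (f : a ⟶ a') : IsUnitary (luNat' f).hom
  luUnit_unitary (a : B) : IsUnitary (luUnit a).hom
  luCounit_unitary (a : B) : IsUnitary (luCounit a).hom
  ruNat_unitary {a a' : B} (f : a ⟶ a') : IsUnitary (ruNat f).hom
  ruNat'_unitary {a a' : B} (f : a ⟶ a') : IsUnitary (ruNat' f).hom
  ruUnit_unitary (a : B) : IsUnitary (ruUnit a).hom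
  ruCounit_unitary (a : B) : IsUnitary (ruCounit a).hom
  pent_unitary (a b c d : B) : IsUnitary (pent a b c d).hom
  midUnit_unitary (a b : B) : IsUnitary (midUnit a b).hom
  leftUnit_unitary (a b : B) : IsUnitary (leftUnit a b).hom
  rightUnit_unitary (a b : B) : IsUnitary (rightUnit a b).hom
  brNat_unitary {a a' b b' : B} (f : a ⟶ a') (g : b ⟶ b') : IsUnitary (brNat f g).hom
  brNat'_unitary {a a' b b' : B} (f : a ⟶ a') (g : b ⟶ b') : IsUnitary (brNat' f g).hom
  brUnit_unitary (a b : B) : IsUnitary (brUnit a b).hom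
  brCounit_unitary (a b : B) : IsUnitary (brCounit a b).hom
  hexR_unitary (a b c : B) : IsUnitary (hexR a b c).hom
  hexS_unitary (a b c : B) : IsUnitary (hexS a b c).hom
  syl_unitary (a b : B) : IsUnitary (syl a b).hom

/-! ### The symmetric monoidal category of scalars

The scalars are the 1-cells `𝕀 ⟶ 𝕀`, with composition as tensor product. The symmetry
`f ≫ g ≅ g ≫ f` is the braiding of `f ⊠ g`, transported along the canonical 2-cell that identifies
`f ⊠ g` with `f ≫ g`. -/

section Scalars

variable {B : Type u} [Bicategory.{w, v} B] [SymmetricMonoidalBicategory B]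

open MonoidalBicategoryCells BraidedCells

/-- `- ⋊ 𝕀` reflects isomorphisms of 1-cells. -/
def unwhisker {a b : B} {f g : a ⟶ b} (i : f ⋊ 𝕀 B ≅ g ⋊ 𝕀 B) : f ≅ g :=
  cancelLeft (ru a) (ru' a) (ruCounit a)
    ((ruNat f).symm ≪≫ whiskerRightIso i (ru b) ≪≫ ruNat g)

variable (B) in
/-- The canonical 2-cell between the two unitors `𝕀 ⊠ 𝕀 ⟶ 𝕀`. -/
def luIsoRu : lu (𝕀 B) ≅ ru (𝕀 B) :=
  unwhisker
    ((leftUnit (𝕀 B) (𝕀 B)).symm ≪≫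
      whiskerLeftIso (asc (𝕀 B) (𝕀 B) (𝕀 B))
        (cancelRight (lu (𝕀 B)) (lu' (𝕀 B)) (luUnit (𝕀 B)) (luNat (lu (𝕀 B))).symm) ≪≫
      midUnit (𝕀 B) (𝕀 B))

/-- The canonical 2-cell relating the braiding with the unit object to the unitors. -/
def ruIsoBrLu (a : B) : ru a ≅ br a (𝕀 B) ≫ lu a :=
  unwhisker (cancelRight (br a (𝕀 B)) (br' a (𝕀 B)) (brUnit a (𝕀 B))
    (whiskerRightIso (midUnit a (𝕀 B)).symm (br a (𝕀 B)) ≪⊗≫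
      whiskerLeftIso (asc a (𝕀 B) (𝕀 B)) (brNatR a (lu (𝕀 B))) ≪⊗≫
      whiskerLeftIso (asc a (𝕀 B) (𝕀 B) ≫ br a (𝕀 B ⊠ 𝕀 B)) (leftUnit (𝕀 B) a).symm ≪⊗≫
      whiskerRightIso (hexR a (𝕀 B) (𝕀 B)) (lu (𝕀 B ⊠ a)) ≪⊗≫
      whiskerLeftIso ((br a (𝕀 B) ⋊ 𝕀 B) ≫ asc (𝕀 B) a (𝕀 B)) (luNat (br a (𝕀 B))) ≪⊗≫
      whiskerLeftIso (br a (𝕀 B) ⋊ 𝕀 B)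
        (whiskerRightIso (leftUnit a (𝕀 B)) (br a (𝕀 B))) ≪⊗≫
      whiskerRightIso (rwComp (br a (𝕀 B)) (lu a) (𝕀 B)).symm (br a (𝕀 B))))

/-- The canonical 2-cell identifying the tensor product of scalars with their composite. -/
def tensorIsoComp (f g : 𝕀 B ⟶ 𝕀 B) : (f ⊠₁ g) ≫ lu (𝕀 B) ≅ lu (𝕀 B) ≫ f ≫ g :=
  whiskerRightIso (t2Iso (ρ_ f).symm (λ_ g).symm ≪≫ tComp f (𝟙 _) (𝟙 _) g) (lu (𝕀 B)) ≪⊗≫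
    whiskerLeftIso (f ⋊ 𝕀 B) (luNat g) ≪⊗≫
    whiskerLeftIso (f ⋊ 𝕀 B) (whiskerRightIso (luIsoRu B) g) ≪⊗≫
    whiskerRightIso (ruNat f) g ≪⊗≫
    whiskerRightIso (luIsoRu B).symm (f ≫ g)

/-- The symmetry of the category of scalars. -/
def scalarSwap (f g : 𝕀 B ⟶ 𝕀 B) : f ≫ g ≅ g ≫ f :=
  cancelLeft (lu (𝕀 B)) (lu' (𝕀 B)) (luCounit (𝕀 B))
    ((tensorIsoComp f g).symm ≪≫
      whiskerLeftIso (f ⊠₁ g) (luIsoRu B ≪≫ ruIsoBrLu (𝕀 B)) ≪⊗≫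
      whiskerRightIso (brNat f g) (lu (𝕀 B)) ≪⊗≫
      whiskerLeftIso (br (𝕀 B) (𝕀 B)) (tensorIsoComp g f) ≪⊗≫
      whiskerRightIso (luIsoRu B ≪≫ ruIsoBrLu (𝕀 B)).symm (g ≫ f))

end Scalars

section Measurement

variable {B : Type u} [Bicategory.{w, v} B] [DaggerSymmetricMonoidalBicategory B]

/-- A commutative †-Frobenius algebra in the symmetric monoidal category of scalars: a commutative
monoid whose multiplication and reversed multiplication satisfy the Frobenius equation. -/
structure CommDaggerFrobeniusAlgebra (X : 𝕀 B ⟶ 𝕀 B) extends MonObj X where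
  /-- the multiplication is commutative -/
  mul_comm : (scalarSwap X X).hom ≫ mul = mul
  /-- the Frobenius equation -/
  frobenius : X ◁ mul † ≫ (α_ X X X).inv ≫ mul ▷ X = mul † ▷ X ≫ (α_ X X X).hom ≫ X ◁ mul

/-- The multiplication on `l ≫ r : 𝕀 ⟶ 𝕀` induced by a 2-cell `r ≫ l ⟶ 𝟙 A`. -/
def inducedMul {A : B} (l : 𝕀 B ⟶ A) (r : A ⟶ 𝕀 B) (compare : r ≫ l ⟶ 𝟙 A) :
    (l ≫ r) ≫ (l ≫ r) ⟶ l ≫ r :=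
  (α_ l r (l ≫ r)).hom ≫ l ◁ ((α_ r l r).inv ≫ compare ▷ r ≫ (λ_ r).hom)

/-- Witnesses for an object `A`: 1-cells `𝕀 ⟶ A` and `A ⟶ 𝕀` which are ambidextrous duals, with
2-cells creating, deleting, copying and comparing classical data; deleting is the reversal of
creating and copying is the reversal of comparing, copying followed by comparing is the identity,
and comparing is commutative. -/
structure Witness (A : B) where
  /-- the witness `𝕀 ⟶ A` -/
  left : 𝕀 B ⟶ A
  /-- the witness `A ⟶ 𝕀` -/
  right : A ⟶ 𝕀 B
  /-- the duality whose unit creates, and whose counit compares, classical data -/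
  adj : left ⊣ right
  /-- the duality whose unit copies, and whose counit deletes, classical data -/
  coadj : right ⊣ left
  copy_eq : coadj.unit = adj.counit †
  delete_eq : coadj.counit = adj.unit †
  copy_compare : coadj.unit ≫ adj.counit = 𝟙 (𝟙 A)
  compare_comm : (scalarSwap (left ≫ right) (left ≫ right)).hom ≫
    inducedMul left right adj.counit = inducedMul left right adj.counit

namespace Witness

variable {A : B} (W : Witness A)

/-- The composite `𝕀 ⟶ A ⟶ 𝕀` of the witnesses. -/
abbrev system : 𝕀 B ⟶ 𝕀 B := W.left ≫ W.right

/-- Create uniform classical data. -/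
abbrev create : 𝟙 (𝕀 B) ⟶ W.system := W.adj.unit

/-- Compare classical data. -/
abbrev compare : W.right ≫ W.left ⟶ 𝟙 A := W.adj.counit

/-- The multiplication on the witnessing system, which compares the classical data of the two
factors. -/
abbrev mul : W.system ≫ W.system ⟶ W.system := inducedMul W.left W.right W.compare

end Witness

/-- A nondegenerate measurement of the system `S`, with outcomes in the object `A` witnessed by
`W`: a unitary 2-cell from `S` to the composite `𝕀 ⟶ A ⟶ 𝕀` of the witnesses. -/
structure NondegenerateMeasurement {A : B} (W : Witness A) (S : 𝕀 B ⟶ 𝕀 B) where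
  /-- the measurement 2-cell -/
  toHom : S ⟶ W.system
  unitary : IsUnitary toHom

end Measurement

end TwoCat

end

/-! An adjunction `l ⊣ r` makes `l ≫ r` a monoid under composition, as for any monad arising from an
adjunction. The multiplication merges the inner `r ≫ l` with the counit. Its associativity is
interchange of two counits acting in disjoint places (`compareMul_assoc`), and its unit laws are the
two triangle identities (`unit_compareMul`, `compareMul_unit`). Reversal turns the multiplication
into the comultiplication that inserts the reversed counit in the middle (`dag_compareMul`). By
interchange, both sides of the Frobenius equation equal "compare, then copy"
(`compareMul_frobenius`). Commutativity is part of the witness data.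

Unitarity makes the inverse of a measurement its reversal. Conjugating by it therefore transports
the monoid and its reversed multiplication together, and the Frobenius equation holds by cancelling
inverse pairs (`frobenius_transport`). Commutativity survives transport only if the symmetry is
natural. Since `scalarSwap` is built from the braiding through a chain of unitors and cancellations
of equivalences, this requires checking naturality link by link, ending in `scalarSwap_naturality`.
-/

namespace TwoCat

/-! ### Naturality of the symmetry of the scalars. -/

section Naturality

variable {B : Type u} [Bicategory.{w, v} B]

/-- Cancelling `e` conjugates `e' ◁ i` by whiskerings of `ξ` and coherence cells, all natural in the
remaining 1-cell. Compatibility of `i` with `σ` and `τ` is thus inherited, and no triangle identity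
for `ξ` enters. -/
theorem cancelLeft_naturality {X Y Z : B} {f g f' g' : Y ⟶ Z} (e : X ⟶ Y) (e' : Y ⟶ X)
    (ξ : e' ≫ e ≅ 𝟙 Y) (i : e ≫ f ≅ e ≫ g) (i' : e ≫ f' ≅ e ≫ g') (σ : f ⟶ f') (τ : g ⟶ g')
    (h : e ◁ σ ≫ i'.hom = i.hom ≫ e ◁ τ) :
    σ ≫ (cancelLeft e e' ξ i').hom = (cancelLeft e e' ξ i).hom ≫ τ := by
  have h' : e' ◁ e ◁ σ ≫ e' ◁ i'.hom = e' ◁ i.hom ≫ e' ◁ e ◁ τ := by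
    simp only [← whiskerLeft_comp, h]
  simp only [cancelLeft, bicategoricalIsoComp, Iso.trans_hom, Iso.symm_hom, whiskerRightIso_hom,
    whiskerLeftIso_hom, Category.assoc, BicategoricalCoherence.assoc_iso,
    BicategoricalCoherence.assoc'_iso]
  -- `σ` is pushed to the right and `τ` to the left until both are adjacent to the whiskered `i'`
  -- and `i`, where `h'` applies.
  rw [leftUnitor_inv_naturality_assoc, whisker_exchange_assoc, comp_whiskerLeft_assoc,
    ← leftUnitor_naturality, ← whisker_exchange_assoc, comp_whiskerLeft_assoc]
  simp [reassoc_of% h']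

variable [SymmetricMonoidalBicategory B]

open MonoidalBicategoryData

/-- Tensor product of 2-cells. -/
abbrev t2Hom {a a' b b' : B} {f f' : a ⟶ a'} {g g' : b ⟶ b'} (η : f ⟶ f') (θ : g ⟶ g') :
    tHom f g ⟶ tHom f' g' :=
  tensor.map₂ (a := (a, b)) (b := (a', b')) (f := (f, g)) (g := (f', g')) (η, θ)

theorem t2Hom_comp {a a' b b' : B} {f f' f'' : a ⟶ a'} {g g' g'' : b ⟶ b'} (η : f ⟶ f')
    (η' : f' ⟶ f'') (θ : g ⟶ g') (θ' : g' ⟶ g'') :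
    t2Hom η θ ≫ t2Hom η' θ' = t2Hom (η ≫ η') (θ ≫ θ') :=
  (tensor.map₂_comp (a := (a, b)) (b := (a', b')) (f := (f, g)) (g := (f', g'))
    (h := (f'', g'')) (η, θ) (η', θ')).symm

theorem t2Iso_hom {a a' b b' : B} {f f' : a ⟶ a'} {g g' : b ⟶ b'} (η : f ≅ f') (θ : g ≅ g') :
    (t2Iso η θ).hom = t2Hom η.hom θ.hom := rfl

theorem tComp_naturality_left {a a' a'' b b' b'' : B} {f₁ f₂ : a ⟶ a'} {g₁ g₂ : b ⟶ b'}
    (σ : f₁ ⟶ f₂) (τ : g₁ ⟶ g₂) (f : a' ⟶ a'') (g : b' ⟶ b'') :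
    t2Hom (σ ▷ f) (τ ▷ g) ≫ (tComp f₂ f g₂ g).hom =
      (tComp f₁ f g₁ g).hom ≫ t2Hom σ τ ▷ tHom f g := by
  have h := tensor.map₂_whisker_right (a := (a, b)) (b := (a', b')) (c := (a'', b''))
    (f := (f₁, g₁)) (g := (f₂, g₂)) (σ, τ) (f, g)
  rw [← Category.assoc] at h
  exact (Iso.eq_comp_inv _).1 h

theorem tComp_naturality_right {a a' a'' b b' b'' : B} (f : a ⟶ a') (g : b ⟶ b')
    {f₁ f₂ : a' ⟶ a''} {g₁ g₂ : b' ⟶ b''} (σ : f₁ ⟶ f₂) (τ : g₁ ⟶ g₂) :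
    t2Hom (f ◁ σ) (g ◁ τ) ≫ (tComp f f₂ g g₂).hom =
      (tComp f f₁ g g₁).hom ≫ tHom f g ◁ t2Hom σ τ := by
  have h := tensor.map₂_whisker_left (a := (a, b)) (b := (a', b')) (c := (a'', b''))
    (f, g) (g := (f₁, g₁)) (h := (f₂, g₂)) (σ, τ)
  rw [← Category.assoc] at h
  exact (Iso.eq_comp_inv _).1 h

theorem luNat_naturality {a a' : B} {f f' : a ⟶ a'} (σ : f ⟶ f') :
    t2Hom (𝟙 (𝟙 (𝕀 B))) σ ▷ lu a' ≫ (luNat f').hom = (luNat f).hom ≫ lu a ◁ σ :=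
  (MonoidalBicategoryData.leftUnitor (B := B)).hom.naturality_naturality σ

theorem ruNat_naturality {a a' : B} {f f' : a ⟶ a'} (σ : f ⟶ f') :
    t2Hom σ (𝟙 (𝟙 (𝕀 B))) ▷ ru a' ≫ (ruNat f').hom = (ruNat f).hom ≫ ru a ◁ σ :=
  (MonoidalBicategoryData.rightUnitor (B := B)).hom.naturality_naturality σ

theorem brNat_naturality {a a' b b' : B} {f f' : a ⟶ a'} {g g' : b ⟶ b'} (σ : f ⟶ f')
    (τ : g ⟶ g') :
    t2Hom σ τ ▷ br a' b' ≫ (brNat f' g').hom = (brNat f g).hom ≫ br a b ◁ t2Hom τ σ :=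
  (BraidingData.braiding (B := B)).hom.naturality_naturality (a := (a, b)) (b := (a', b'))
    (f := (f, g)) (g := (f', g')) (σ, τ)

/-- An explicit normal form: the coherence cells hidden in `⊗≫` become single associators, so that
naturality can be applied factor by factor. -/
theorem tensorIsoComp_hom (f g : 𝕀 B ⟶ 𝕀 B) :
    (tensorIsoComp f g).hom = (t2Hom (ρ_ f).inv (λ_ g).inv ≫ (tComp f (𝟙 _) (𝟙 _) g).hom) ▷
      lu (𝕀 B) ≫ (α_ _ _ _).hom ≫ rwh f (𝕀 B) ◁ ((luNat g).hom ≫ (luIsoRu B).hom ▷ g) ≫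
      (α_ _ _ _).inv ≫ ((ruNat f).hom ≫ (luIsoRu B).inv ▷ f) ▷ g ≫ (α_ _ _ _).hom := by
  simp only [tensorIsoComp, bicategoricalIsoComp, Iso.trans_hom, Iso.symm_hom, whiskerRightIso_hom,
    whiskerLeftIso_hom, t2Iso_hom]
  simp

/-- The cells fall into three groups. `σ` passes the splitting of `f ⊠ g` by naturality of the
tensor compositor (`h₁`), the cells that move `g` past a unitor by interchange, and those that move
`f` by naturality of the right unitor (`h₂`). -/
theorem tensorIsoComp_naturality_left {f f' : 𝕀 B ⟶ 𝕀 B} (σ : f ⟶ f') (g : 𝕀 B ⟶ 𝕀 B) :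
    t2Hom σ (𝟙 g) ▷ lu (𝕀 B) ≫ (tensorIsoComp f' g).hom =
      (tensorIsoComp f g).hom ≫ lu (𝕀 B) ◁ σ ▷ g := by
  have h₁ : t2Hom σ (𝟙 g) ≫ t2Hom (ρ_ f').inv (λ_ g).inv ≫ (tComp f' (𝟙 _) (𝟙 _) g).hom =
      (t2Hom (ρ_ f).inv (λ_ g).inv ≫ (tComp f (𝟙 _) (𝟙 _) g).hom) ≫
        t2Hom σ (𝟙 (𝟙 (𝕀 B))) ▷ tHom (𝟙 (𝕀 B)) g := by
    rw [Category.assoc, ← tComp_naturality_left, reassoc_of% t2Hom_comp, reassoc_of% t2Hom_comp,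
      rightUnitor_inv_naturality, id_whiskerRight, Category.id_comp, Category.comp_id]
  have h₂ : t2Hom σ (𝟙 (𝟙 (𝕀 B))) ▷ ru (𝕀 B) ≫ (ruNat f').hom ≫ (luIsoRu B).inv ▷ f' =
      ((ruNat f).hom ≫ (luIsoRu B).inv ▷ f) ≫ lu (𝕀 B) ◁ σ := by
    rw [reassoc_of% ruNat_naturality, whisker_exchange, Category.assoc]
  rw [tensorIsoComp_hom, tensorIsoComp_hom, ← comp_whiskerRight_assoc, h₁, comp_whiskerRight_assoc]
  simp only [Category.assoc]
  rw [associator_naturality_left_assoc, ← whisker_exchange_assoc,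
    associator_inv_naturality_left_assoc, ← comp_whiskerRight_assoc, h₂]
  simp only [comp_whiskerRight, Category.assoc, associator_naturality_middle]

/-- The mirror argument: here `τ` meets the left unitor directly (`h₂`) and passes the cells that
move `f` by interchange. -/
theorem tensorIsoComp_naturality_right (f : 𝕀 B ⟶ 𝕀 B) {g g' : 𝕀 B ⟶ 𝕀 B} (τ : g ⟶ g') :
    t2Hom (𝟙 f) τ ▷ lu (𝕀 B) ≫ (tensorIsoComp f g').hom =
      (tensorIsoComp f g).hom ≫ lu (𝕀 B) ◁ f ◁ τ := by
  have h₁ : t2Hom (𝟙 f) τ ≫ t2Hom (ρ_ f).inv (λ_ g').inv ≫ (tComp f (𝟙 _) (𝟙 _) g').hom =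
      (t2Hom (ρ_ f).inv (λ_ g).inv ≫ (tComp f (𝟙 _) (𝟙 _) g).hom) ≫
        rwh f (𝕀 B) ◁ t2Hom (𝟙 (𝟙 (𝕀 B))) τ := by
    rw [Category.assoc, ← tComp_naturality_right, reassoc_of% t2Hom_comp, reassoc_of% t2Hom_comp,
      leftUnitor_inv_naturality, whiskerLeft_id, Category.id_comp, Category.comp_id]
  have h₂ : t2Hom (𝟙 (𝟙 (𝕀 B))) τ ▷ lu (𝕀 B) ≫ (luNat g').hom ≫ (luIsoRu B).hom ▷ g' =
      ((luNat g).hom ≫ (luIsoRu B).hom ▷ g) ≫ ru (𝕀 B) ◁ τ := by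
    rw [reassoc_of% luNat_naturality, whisker_exchange, Category.assoc]
  rw [tensorIsoComp_hom, tensorIsoComp_hom, ← comp_whiskerRight_assoc, h₁, comp_whiskerRight_assoc]
  simp only [Category.assoc]
  rw [associator_naturality_middle_assoc, ← whiskerLeft_comp_assoc, h₂, whiskerLeft_comp_assoc,
    associator_inv_naturality_right_assoc, whisker_exchange_assoc, associator_naturality_right]

theorem tensorIsoComp_naturality {f f' g g' : 𝕀 B ⟶ 𝕀 B} (σ : f ⟶ f') (τ : g ⟶ g') :
    t2Hom σ τ ▷ lu (𝕀 B) ≫ (tensorIsoComp f' g').hom =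
      (tensorIsoComp f g).hom ≫ lu (𝕀 B) ◁ (σ ▷ g ≫ f' ◁ τ) := by
  have h : t2Hom σ τ = t2Hom σ (𝟙 g) ≫ t2Hom (𝟙 f') τ := by
    rw [t2Hom_comp, Category.comp_id, Category.id_comp]
  rw [h, comp_whiskerRight_assoc, tensorIsoComp_naturality_right,
    reassoc_of% tensorIsoComp_naturality_left, whiskerLeft_comp]

/-- The symmetry is the naturality cell of the braiding, conjugated by `tensorIsoComp` and by a
comparison of 1-cells independent of the scalars. The first two are natural, and the last commutes
with `σ` and `τ` by interchange. This is what lets commutativity be transported. -/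
theorem scalarSwap_naturality {f f' g g' : 𝕀 B ⟶ 𝕀 B} (σ : f ⟶ f') (τ : g ⟶ g') :
    (σ ▷ g ≫ f' ◁ τ) ≫ (scalarSwap f' g').hom =
      (scalarSwap f g).hom ≫ τ ▷ f ≫ g' ◁ σ := by
  apply cancelLeft_naturality
  have h : lu (𝕀 B) ◁ (σ ▷ g ≫ f' ◁ τ) ≫ (tensorIsoComp f' g').inv =
      (tensorIsoComp f g).inv ≫ t2Hom σ τ ▷ lu (𝕀 B) := by
    rw [Iso.comp_inv_eq, Category.assoc, tensorIsoComp_naturality, Iso.inv_hom_id_assoc]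
  -- `j` stands for `luIsoRu B ≪≫ ruIsoBrLu (𝕀 B)`. It can be left arbitrary because only its source
  -- and target matter.
  have e (f g : 𝕀 B ⟶ 𝕀 B) (j : lu (𝕀 B) ≅ br (𝕀 B) (𝕀 B) ≫ lu (𝕀 B)) :
      ((tensorIsoComp f g).symm ≪≫ whiskerLeftIso (tHom f g) j ≪⊗≫
        whiskerRightIso (brNat f g) (lu (𝕀 B)) ≪⊗≫
        whiskerLeftIso (br (𝕀 B) (𝕀 B)) (tensorIsoComp g f) ≪⊗≫
        whiskerRightIso j.symm (g ≫ f)).hom =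
      (tensorIsoComp f g).inv ≫ tHom f g ◁ j.hom ≫ (α_ _ _ _).inv ≫
        (brNat f g).hom ▷ lu (𝕀 B) ≫ (α_ _ _ _).hom ≫
        br (𝕀 B) (𝕀 B) ◁ (tensorIsoComp g f).hom ≫ (α_ _ _ _).inv ≫ j.inv ▷ (g ≫ f) := by
    simp only [bicategoricalIsoComp, Iso.trans_hom, Iso.symm_hom, whiskerRightIso_hom,
      whiskerLeftIso_hom]
    simp
  rw [e, e, reassoc_of% h, ← whisker_exchange_assoc, associator_inv_naturality_left_assoc,
    ← comp_whiskerRight_assoc, brNat_naturality, comp_whiskerRight_assoc,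
    associator_naturality_middle_assoc, ← whiskerLeft_comp_assoc, tensorIsoComp_naturality,
    whiskerLeft_comp_assoc, associator_inv_naturality_right_assoc, whisker_exchange]
  simp only [Category.assoc]

end Naturality

/-! ### Monoid and Frobenius laws for the composite of an adjoint pair. -/

section Bicategory

variable {B : Type u} [Bicategory.{w, v} B] {a b : B} {l : a ⟶ b} {r : b ⟶ a}

/-- The multiplication on `l ≫ r` induced by a 2-cell `r ≫ l ⟶ 𝟙 b`. -/
abbrev compareMul (c : r ≫ l ⟶ 𝟙 b) : (l ≫ r) ≫ (l ≫ r) ⟶ l ≫ r :=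
  (α_ l r (l ≫ r)).hom ≫ l ◁ ((α_ r l r).inv ≫ c ▷ r ≫ (λ_ r).hom)

/-- The comultiplication on `l ≫ r` induced by a 2-cell `𝟙 b ⟶ r ≫ l`. -/
abbrev copyComul (d : 𝟙 b ⟶ r ≫ l) : l ≫ r ⟶ (l ≫ r) ≫ (l ≫ r) :=
  l ◁ ((λ_ r).inv ≫ d ▷ r ≫ (α_ r l r).hom) ≫ (α_ l r (l ≫ r)).inv

/-- In `l r l r l r` the two copies of `r l` are disjoint, so the order in which `c` is applied to
them is immaterial. -/
theorem compareMul_assoc (c : r ≫ l ⟶ 𝟙 b) :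
    compareMul c ▷ (l ≫ r) ≫ compareMul c =
      (α_ _ _ _).hom ≫ (l ≫ r) ◁ compareMul c ≫ compareMul c := by
  calc
    _ = 𝟙 _ ⊗≫ l ◁ (c ▷ (r ≫ l) ≫ 𝟙 b ◁ c) ▷ r ⊗≫ 𝟙 _ := by bicategory
    _ = 𝟙 _ ⊗≫ l ◁ ((r ≫ l) ◁ c ≫ c ▷ 𝟙 b) ▷ r ⊗≫ 𝟙 _ := by rw [whisker_exchange]
    _ = _ := by bicategory

/-- Pure interchange, for arbitrary `c` and `d`: on either side `d` creates a new `r l` next to the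
one that `c` consumes, so `c` may act first. Both sides become `compareMul c` followed by `copyComul
d`. -/
theorem compareMul_frobenius (c : r ≫ l ⟶ 𝟙 b) (d : 𝟙 b ⟶ r ≫ l) :
    (l ≫ r) ◁ copyComul d ≫ (α_ _ _ _).inv ≫ compareMul c ▷ (l ≫ r) =
      copyComul d ▷ (l ≫ r) ≫ (α_ _ _ _).hom ≫ (l ≫ r) ◁ compareMul c := by
  calc
    _ = 𝟙 _ ⊗≫ l ◁ ((r ≫ l) ◁ d ≫ c ▷ (r ≫ l)) ▷ r ⊗≫ 𝟙 _ := by bicategory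
    -- This symmetric form is the meeting point of the two sides.
    _ = 𝟙 _ ⊗≫ l ◁ c ▷ r ⊗≫ l ◁ d ▷ r ⊗≫ 𝟙 _ := by rw [whisker_exchange]; bicategory
    _ = 𝟙 _ ⊗≫ l ◁ (d ▷ (r ≫ l) ≫ (r ≫ l) ◁ c) ▷ r ⊗≫ 𝟙 _ := by
      rw [← whisker_exchange]; bicategory
    _ = _ := by bicategory

/-- The new unit and the counit act only on the factor `l`, where they form the left zigzag. For the
right unit law they act on `r` and form the right zigzag. -/
theorem unit_compareMul (adj : l ⊣ r) :
    adj.unit ▷ (l ≫ r) ≫ compareMul adj.counit = (λ_ (l ≫ r)).hom := by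
  calc
    _ = 𝟙 _ ⊗≫ leftZigzag adj.unit adj.counit ▷ r ⊗≫ 𝟙 _ := by
      dsimp only [leftZigzag]; bicategory
    _ = _ := by rw [adj.left_triangle]; bicategory

theorem compareMul_unit (adj : l ⊣ r) :
    (l ≫ r) ◁ adj.unit ≫ compareMul adj.counit = (ρ_ (l ≫ r)).hom := by
  calc
    _ = 𝟙 _ ⊗≫ l ◁ rightZigzag adj.unit adj.counit ⊗≫ 𝟙 _ := by
      dsimp only [rightZigzag]; bicategory
    _ = _ := by rw [adj.right_triangle]; bicategory

theorem dag_compareMul [DaggerBicategory B] (c : r ≫ l ⟶ 𝟙 b) :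
    DaggerBicategory.dag (compareMul c) = copyComul (DaggerBicategory.dag c) := by
  -- The axioms give the reversal of the forward associator only; involutivity supplies the inverse
  -- one.
  have h : DaggerBicategory.dag (α_ r l r).inv = (α_ r l r).hom := by
    rw [← DaggerBicategory.dag_associator, DaggerBicategory.dag_dag]
  simp only [compareMul, copyComul, DaggerBicategory.dag_comp, DaggerBicategory.dag_whiskerLeft,
    DaggerBicategory.dag_whiskerRight, DaggerBicategory.dag_associator,
    DaggerBicategory.dag_leftUnitor, h, Category.assoc]

end Bicategory

/-! ### Transport of the Frobenius equation along an isomorphism. -/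

section Transport

open MonoidalCategory

/-- Each side is the corresponding side of `h` conjugated by tensor powers of `e`. No reversal is
involved, so `d` is an arbitrary 1-parameter datum here; it becomes the reversed multiplication when
applied to scalars. -/
theorem frobenius_transport {C : Type u} [Category.{v} C] [MonoidalCategory C] {S X : C}
    (e : S ≅ X) {m : X ⊗ X ⟶ X} {d : X ⟶ X ⊗ X}
    (h : MonoidalCategory.whiskerLeft X d ≫ (MonoidalCategory.associator X X X).inv ≫
        MonoidalCategory.whiskerRight m X =
      MonoidalCategory.whiskerRight d X ≫ (MonoidalCategory.associator X X X).hom ≫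
        MonoidalCategory.whiskerLeft X m) :
    MonoidalCategory.whiskerLeft S (e.hom ≫ d ≫ (e.inv ⊗ₘ e.inv)) ≫
        (MonoidalCategory.associator S S S).inv ≫
        MonoidalCategory.whiskerRight ((e.hom ⊗ₘ e.hom) ≫ m ≫ e.inv) S =
      MonoidalCategory.whiskerRight (e.hom ≫ d ≫ (e.inv ⊗ₘ e.inv)) S ≫
        (MonoidalCategory.associator S S S).hom ≫
        MonoidalCategory.whiskerLeft S ((e.hom ⊗ₘ e.hom) ≫ m ≫ e.inv) := by
  simp only [← id_tensorHom, ← tensorHom_id] at h ⊢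
  have h₁ : 𝟙 S ⊗ₘ (e.hom ≫ d ≫ (e.inv ⊗ₘ e.inv)) =
      (e.hom ⊗ₘ e.hom) ≫ (𝟙 X ⊗ₘ d) ≫ (e.inv ⊗ₘ (e.inv ⊗ₘ e.inv)) := by
    simp only [tensorHom_comp_tensorHom, Category.id_comp, e.hom_inv_id]
  have h₂ : ((e.hom ⊗ₘ e.hom) ≫ m ≫ e.inv) ⊗ₘ 𝟙 S =
      ((e.hom ⊗ₘ e.hom) ⊗ₘ e.hom) ≫ (m ⊗ₘ 𝟙 X) ≫ (e.inv ⊗ₘ e.inv) := by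
    simp only [tensorHom_comp_tensorHom, Category.id_comp, e.hom_inv_id]
  have h₃ : (e.hom ≫ d ≫ (e.inv ⊗ₘ e.inv)) ⊗ₘ 𝟙 S =
      (e.hom ⊗ₘ e.hom) ≫ (d ⊗ₘ 𝟙 X) ≫ ((e.inv ⊗ₘ e.inv) ⊗ₘ e.inv) := by
    simp only [tensorHom_comp_tensorHom, Category.id_comp, e.hom_inv_id]
  have h₄ : 𝟙 S ⊗ₘ ((e.hom ⊗ₘ e.hom) ≫ m ≫ e.inv) =
      (e.hom ⊗ₘ (e.hom ⊗ₘ e.hom)) ≫ (𝟙 X ⊗ₘ m) ≫ (e.inv ⊗ₘ e.inv) := by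
    simp only [tensorHom_comp_tensorHom, Category.id_comp, e.hom_inv_id]
  -- The threefold powers meet across the associator. Naturality brings both sides to this
  -- bracketing, so one cancellation serves twice.
  have h₅ : (e.inv ⊗ₘ (e.inv ⊗ₘ e.inv)) ≫ (e.hom ⊗ₘ (e.hom ⊗ₘ e.hom)) = 𝟙 _ := by
    simp only [tensorHom_comp_tensorHom, e.inv_hom_id, id_tensorHom_id]
  rw [h₁, h₂, h₃, h₄]
  simp only [Category.assoc]
  rw [← MonoidalCategory.associator_inv_naturality_assoc, reassoc_of% h₅,
    MonoidalCategory.associator_naturality_assoc, reassoc_of% h₅]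
  simp only [reassoc_of% h]

end Transport

/-! ### The algebras on the witnessing system and on the measured system. -/

section Frobenius

variable {B : Type u} [Bicategory.{w, v} B] [DaggerSymmetricMonoidalBicategory B]

/-- The commutative †-Frobenius algebra on the composite of the witnesses. -/
def Witness.frobeniusAlgebra {A : B} (W : Witness A) : CommDaggerFrobeniusAlgebra W.system where
  one := W.create
  mul := W.mul
  one_mul := unit_compareMul W.adj
  mul_one := compareMul_unit W.adj
  mul_assoc := compareMul_assoc W.compare
  mul_comm := W.compare_comm
  frobenius := by
    have h : DaggerBicategory.dag W.mul = copyComul (DaggerBicategory.dag W.compare) :=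
      dag_compareMul W.compare
    rw [h]
    exact compareMul_frobenius W.compare _

/-- A unitary 2-cell as an isomorphism. -/
def IsUnitary.toIso {a b : B} {f g : a ⟶ b} {u : f ⟶ g} (hu : IsUnitary u) : f ≅ g where
  hom := u
  inv := DaggerBicategory.dag u
  hom_inv_id := hu.1
  inv_hom_id := hu.2

/-- Transport of a commutative †-Frobenius algebra along a unitary 2-cell. -/
def CommDaggerFrobeniusAlgebra.transport {X S : 𝕀 B ⟶ 𝕀 B} (F : CommDaggerFrobeniusAlgebra X)
    {u : S ⟶ X} (hu : IsUnitary u) : CommDaggerFrobeniusAlgebra S where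
  toMonObj :=
    letI := F.toMonObj
    -- The inverse in `hu.toIso` is the reversal of `u`, so the transported unit and multiplication
    -- have the required form definitionally.
    MonObj.ofIso hu.toIso.symm
  mul_comm := by
    change (scalarSwap S S).hom ≫ (u ▷ S ≫ X ◁ u) ≫ F.mul ≫ DaggerBicategory.dag u =
      (u ▷ S ≫ X ◁ u) ≫ F.mul ≫ DaggerBicategory.dag u
    -- Naturality moves the symmetry past `u ⊗ u`, where the commutative multiplication on `X`
    -- absorbs it.
    rw [← Category.assoc, ← scalarSwap_naturality, Category.assoc, reassoc_of% F.mul_comm]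
  frobenius := by
    -- Reversal also reverses the order of the two whiskerings in `u ⊗ u`; interchange restores it.
    -- The result is the comultiplication conjugated by `u`, as `frobenius_transport` expects.
    have h : DaggerBicategory.dag ((u ▷ S ≫ X ◁ u) ≫ F.mul ≫ DaggerBicategory.dag u) =
        u ≫ DaggerBicategory.dag F.mul ≫
          (DaggerBicategory.dag u ▷ X ≫ S ◁ DaggerBicategory.dag u) := by
      simp only [DaggerBicategory.dag_comp, DaggerBicategory.dag_whiskerLeft,
        DaggerBicategory.dag_whiskerRight, DaggerBicategory.dag_dag, Category.assoc,
        whisker_exchange]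
    change S ◁ DaggerBicategory.dag ((u ▷ S ≫ X ◁ u) ≫ F.mul ≫ DaggerBicategory.dag u) ≫ _ =
      DaggerBicategory.dag ((u ▷ S ≫ X ◁ u) ≫ F.mul ≫ DaggerBicategory.dag u) ▷ S ≫ _
    rw [h]
    exact frobenius_transport hu.toIso F.frobenius

end Frobenius

end TwoCat

theorem mainTheorem8 {B : Type u} [Bicategory.{w, v} B]
    [TwoCat.DaggerSymmetricMonoidalBicategory B] {A : B} (W : TwoCat.Witness A)
    {S : TwoCat.𝕀 B ⟶ TwoCat.𝕀 B} (M : TwoCat.NondegenerateMeasurement W S) :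
    ∃ (F : TwoCat.CommDaggerFrobeniusAlgebra W.system) (G : TwoCat.CommDaggerFrobeniusAlgebra S),
      F.mul = W.mul ∧ F.one = W.create ∧
      G.mul = M.toHom ▷ S ≫ W.system ◁ M.toHom ≫ F.mul ≫ TwoCat.DaggerBicategory.dag M.toHom ∧
      G.one = F.one ≫ TwoCat.DaggerBicategory.dag M.toHom :=
  ⟨W.frobeniusAlgebra, W.frobeniusAlgebra.transport M.unitary, rfl, rfl, Category.assoc _ _ _, rfl⟩
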